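/- Let $X\subset\mathbb{C}^n$ be a domain, i.e. a non-empty open connected set. A function $K:X\times X\to\mathbb{C}$ is called sesqui-holomorphic if it is holomorphic in the first variable and antiholomorphic in the second, non-degenerate if $K(x,x)>0$ for all $x\in X$, and positive semi-definite if for all $x_1,\dots,x_m\in X$ the matrix $(K(x_i,x_j))_{i,j=1}^m$ is positive semi-definite. Two non-degenerate functions $K,L$ on $X\times X$ are called rescalings of each other if there is a function $\omega:X\to\mathbb{C}$ such that $K(x,y)=\omega(x)\overline{\omega(y)}L(x,y)$ for all $x,y\in X$ (a symmetric relation). For a positive semi-definite kernel $K$ let $F$ be the reproducing kernel Hilbert space on $X$ with kernel $K$, let $F^*$ be its dual Hilbert space, and let $\kappa:X\to F^*$, $\kappa(x)f=f(x)$, be the evaluation map, so that $K(x,y)=\langle\kappa(x),\kappa(y)\rangle_{F^*}$ (inner products are linear in the first argument). For $g,h\in F^*\setminus\{0\}$ and $f_1,f_2\in F^*$ put $$\tilde\sigma_g(f_1,f_2)=\frac{\langle f_1,f_2\rangle}{\|g\|^2}-\frac{\langle f_1,g\rangle\langle g,f_2\rangle}{\|g\|^4},\qquad \delta_1(g,h)=\sqrt{1-\frac{|\langle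 g,h\rangle|^2}{\|g\|^2\|h\|^2}},\qquad \delta_2(g,h)=\sqrt{2-2\frac{|\langle g,h\rangle|}{\|g\|\|h\|}}.$$ If $K$ is moreover sesqui-holomorphic and non-degenerate, let $\tilde\sigma^K,\delta_1^K,\delta_2^K$ be the pull-backs of these through $\kappa$: $$\tilde\sigma^K_x(u,v)=\tilde\sigma_{\kappa(x)}(D\kappa_x u,D\kappa_x v),\qquad \delta_i^K(x,y)=\delta_i(\kappa(x),\kappa(y))\quad(i=1,2),$$ for $x,y\in X$ and $u,v\in\mathbb{C}^n$, where $D\kappa_x$ is the complex differential of the (holomorphic) map $\kappa$ at $x$. Let $K$ and $L$ be sesqui-holomorphic, non-degenerate, positive semi-definite kernels on $X$. Then the following are equivalent: (i) $K$ and $L$ are rescalings of each other; (ii) $\tilde\sigma^K=\tilde\sigma^L$ on $X$; (iii) $\delta_1^K=\delta_1^L$ on $X\times X$; (iv) $\delta_2^K=\delta_2^L$ on $X\times X$. -/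

import Mathlib

open scoped ComplexOrder ComplexConjugate InnerProductSpace

noncomputable section

namespace KernelMetric

/-! ### Functions of two variables on a set -/

section Kernels

variable {X : Type*}

/-- `L` is non-degenerate: its diagonal values are real and strictly positive. -/
def IsNondegenerate (L : X → X → ℂ) : Prop :=
  ∀ x, 0 < L x x

/-- `M` is a rescaling of `L`: there is `ω : X → ℂ` with `M(x, y) = ω(x) conj(ω(y)) L(x, y)`. -/
def IsRescaling (M L : X → X → ℂ) : Prop :=
  ∃ ω : X → ℂ, ∀ x y, M x y = ω x * conj (ω y) * L x y

/-- `L` and `M` are rescalings if one of them is a rescaling of the other. -/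
def AreRescalings (L M : X → X → ℂ) : Prop :=
  IsRescaling M L ∨ IsRescaling L M

/-- Positive semi-definite kernels: every matrix `(K(x_i, x_j))`, for finitely many points
`x_1, …, x_m` of `X`, is (Hermitian and) positive semi-definite. -/
def IsPosSemidefKernel (K : X → X → ℂ) : Prop :=
  ∀ (m : ℕ) (p : Fin m → X), (Matrix.of fun i j => K (p i) (p j)).PosSemidef

/-- The scalar kernel `K` seen as a kernel with values in the operators on `ℂ`, which is the form
in which Mathlib's reproducing kernel Hilbert spaces take it. -/
def opKernel (K : X → X → ℂ) : Matrix X X (ℂ →L[ℂ] ℂ) :=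
  Matrix.of fun x y => K x y • (1 : ℂ →L[ℂ] ℂ)

theorem IsPosSemidefKernel.conj_symm {K : X → X → ℂ} (hK : IsPosSemidefKernel K) (x y : X) :
    conj (K y x) = K x y := by
  have h := (hK 2 ![x, y]).isHermitian.apply 0 1
  simpa using h

theorem IsPosSemidefKernel.opKernel_posSemidef {K : X → X → ℂ} (hK : IsPosSemidefKernel K) :
    (opKernel K).PosSemidef := by
  have key : (opKernel K).IsHermitian ∧ ∀ f : X →₀ ℂ,
      0 ≤ RCLike.re (f.sum fun x w => f.sum fun x' w' => ⟪opKernel K x' x w, w'⟫_ℂ) := by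
    refine ⟨?_, fun f => ?_⟩
    · ext x y
      have h := hK.conj_symm x y
      simp [opKernel, Matrix.conjTranspose_apply, h]
    · let e := f.support.equivFin
      have h := (hK f.support.card fun i => (e.symm i : X)).dotProduct_mulVec_nonneg
        fun i => f (e.symm i)
      have h' : (f.sum fun x w => f.sum fun x' w' => ⟪opKernel K x' x w, w'⟫_ℂ) =
          star (fun i => f (e.symm i)) ⬝ᵥ
            (Matrix.of fun i j => K (e.symm i : X) (e.symm j)).mulVec fun i => f (e.symm i) := by
        simp only [Finsupp.sum, dotProduct, Matrix.mulVec, Matrix.of_apply, Pi.star_apply]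
        rw [← Finset.sum_coe_sort, ← Equiv.sum_comp e.symm]
        refine Finset.sum_congr rfl fun i _ => ?_
        rw [← Finset.sum_coe_sort, ← Equiv.sum_comp e.symm, Finset.mul_sum]
        refine Finset.sum_congr rfl fun j _ => ?_
        simp [opKernel, hK.conj_symm]
        ring
      rw [h']
      exact (Complex.nonneg_iff.mp h).1
  exact ((RKHS.posSemidef_tfae (K := opKernel K)).out 0 2).mpr key

end Kernels

/-! ### Reproducing kernel Hilbert spaces, their duals and evaluation maps -/

section Dual

variable {H : Type*} [NormedAddCommGroup H] [InnerProductSpace ℂ H] [CompleteSpace H]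

/-- The inner product of the dual `H*`, linear in the first and antilinear in the second argument:
if `l` and `m` are represented by `g` and `h`, so that `l f = ⟪g, f⟫` and `m f = ⟪h, f⟫`, its value
is `⟪g, h⟫` (Mathlib's inner product is antilinear in its first argument). -/
def dualInner (l m : StrongDual ℂ H) : ℂ :=
  ⟪(InnerProductSpace.toDual ℂ H).symm l, (InnerProductSpace.toDual ℂ H).symm m⟫_ℂ

/-- The Fubini-Study (degenerate) Hermitian metric on `H* \ {0}`. -/
def fubiniStudy (g f h : StrongDual ℂ H) : ℂ :=
  (1 / (‖g‖ : ℂ) ^ 2) * dualInner f h - (1 / (‖g‖ : ℂ) ^ 4) * (dualInner f g * dualInner g h)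

/-- The pseudodistance `δ₁` on `H* \ {0}`. -/
def delta₁ (g h : StrongDual ℂ H) : ℝ :=
  √(1 - ‖dualInner g h‖ ^ 2 / (‖g‖ ^ 2 * ‖h‖ ^ 2))

/-- The pseudodistance `δ₂` on `H* \ {0}`. -/
def delta₂ (g h : StrongDual ℂ H) : ℝ :=
  √(2 - 2 * (‖dualInner g h‖ / (‖g‖ * ‖h‖)))

end Dual

section EvalMap

variable {X : Type*} (F : Type*) [NormedAddCommGroup F] [InnerProductSpace ℂ F] [RKHS ℂ F X ℂ]

/-- The evaluation map `κ : X → F*` of a reproducing kernel Hilbert space, `κ(x) f = f(x)`. -/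
def evalMap (x : X) : StrongDual ℂ F :=
  (ContinuousLinearMap.proj x).comp (RKHS.coeCLM ℂ : F →L[ℂ] X → ℂ)

end EvalMap

/-! ### Domains in `ℂⁿ` -/

section Domain

variable {n : ℕ} {X : Set (EuclideanSpace ℂ (Fin n))}

/-- Extension by zero of a function on `X` to `ℂⁿ`. Only its germs at points of the open set `X`
are ever used. -/
def extendZero {V : Type*} [Zero V] (f : X → V) : EuclideanSpace ℂ (Fin n) → V :=
  Function.extend Subtype.val f 0

/-- A function on an open set `X` is holomorphic. -/
def IsHolomorphic (f : X → ℂ) : Prop :=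
  DifferentiableOn ℂ (extendZero f) X

/-- Sesqui-holomorphic functions: holomorphic in the first variable, antiholomorphic (that is, with
holomorphic complex conjugate) in the second. -/
def IsSesquiHolomorphic (L : X → X → ℂ) : Prop :=
  (∀ y, IsHolomorphic fun x => L x y) ∧ ∀ x, IsHolomorphic fun y => conj (L x y)

/-- The derivative `uκ = ∑ u_j ∂κ/∂z_j (x)` of the evaluation map `κ : X → F*` at `x` along the
tangent vector `u = ∑ u_j ∂/∂z_j`. -/
def derivEval (F : Type*) [NormedAddCommGroup F] [InnerProductSpace ℂ F] [RKHS ℂ F X ℂ]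
    (x : X) (u : EuclideanSpace ℂ (Fin n)) : StrongDual ℂ F :=
  fderiv ℂ (extendZero (evalMap F : X → StrongDual ℂ F)) x u

/-- The metric `σ̃^K` on `X`: the pull-back of the Fubini-Study metric on `F* \ {0}` through the
evaluation map of the reproducing kernel Hilbert space `F` with kernel `K`. The tangent space at
each point is identified with `ℂⁿ`. -/
def fubiniStudyPullback (K : X → X → ℂ) (hK : IsPosSemidefKernel K) (x : X)
    (u v : EuclideanSpace ℂ (Fin n)) : ℂ :=
  haveI : Fact (opKernel K).PosSemidef := ⟨hK.opKernel_posSemidef⟩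
  fubiniStudy (evalMap (RKHS.OfKernel (opKernel K)) x)
    (derivEval (RKHS.OfKernel (opKernel K)) x u) (derivEval (RKHS.OfKernel (opKernel K)) x v)

/-- `δ₁^K`: the pull-back of `δ₁` through the evaluation map of the reproducing kernel Hilbert
space with kernel `K`. -/
def delta₁Pullback (K : X → X → ℂ) (hK : IsPosSemidefKernel K) (x y : X) : ℝ :=
  haveI : Fact (opKernel K).PosSemidef := ⟨hK.opKernel_posSemidef⟩
  delta₁ (evalMap (RKHS.OfKernel (opKernel K)) x) (evalMap (RKHS.OfKernel (opKernel K)) y)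

/-- `δ₂^K`: the pull-back of `δ₂` through the evaluation map of the reproducing kernel Hilbert
space with kernel `K`. -/
def delta₂Pullback (K : X → X → ℂ) (hK : IsPosSemidefKernel K) (x y : X) : ℝ :=
  haveI : Fact (opKernel K).PosSemidef := ⟨hK.opKernel_posSemidef⟩
  delta₂ (evalMap (RKHS.OfKernel (opKernel K)) x) (evalMap (RKHS.OfKernel (opKernel K)) y)

end Domain

end KernelMetric

end

/-!
A map `κ` into the dual of a Hilbert space whose Gram kernel `⟨κ x, κ y⟩` is sesqui-holomorphic is
locally bounded, by Hartogs' lemma along complex lines and Baire's theorem, and hence holomorphic.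

For a rescaling, `κ x` and its counterpart for `L` agree up to an isometry and a scalar factor,
which the three invariants do not see. Conversely, each invariant forces the defect
`L(x,p) L(p,y) K(x,y) K(p,p) - K(x,p) K(p,y) L(x,y) L(p,p)` to vanish on the diagonal near `p`:
`δ₁` and `δ₂` are decreasing functions of `|⟨κ x, κ y⟩| / (‖κ x‖ ‖κ y‖)`, and the metric is the
restriction to the diagonal of the mixed derivative `∂²/∂s∂(conj t)` of `log K(s,t)` along complex
lines. A sesqui-holomorphic function is determined by its diagonal, so the defect vanishes on
`X × X`. Hence `K(x,y) = ω(x) conj(ω(y)) L(x,y)` with `ω(x) = c K(x,p) / L(x,p)` on the dense open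
set where `K(x,p) ≠ 0`, and `ω` extends to `X` by continuity.
-/

open Filter MeasureTheory Metric Real Set Topology

namespace KernelMetric

section HolomorphicFunctions

variable {E F : Type*} [NormedAddCommGroup E] [NormedSpace ℂ E] [NormedAddCommGroup F]
  [NormedSpace ℂ F] {f : E → F} {c z : E} {r M : ℝ}

theorem norm_fderiv_le_of_forall_mem_ball_norm_le (hr : 0 < r)
    (hf : DifferentiableOn ℂ f (ball c r)) (hM : ∀ z ∈ ball c r, ‖f z‖ ≤ M) :
    ‖fderiv ℂ f c‖ ≤ 2 * M / r := by
  refine Complex.norm_fderiv_le_div_of_mapsTo_ball hf (fun z hz => ?_) hr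
  rw [mem_closedBall, dist_eq_norm]
  linarith [norm_sub_le (f z) (f c), hM z hz, hM c (mem_ball_self hr)]

theorem norm_sub_sub_fderiv_le_of_forall_mem_ball_norm_le
    (hf : DifferentiableOn ℂ f (ball c r)) (hM : ∀ z ∈ ball c r, ‖f z‖ ≤ M) (hz : z ∈ ball c r) :
    ‖f z - f c - fderiv ℂ f c (z - c)‖ ≤ 4 * M * (dist z c / r) ^ 2 := by
  have hr : 0 < r := nonempty_ball.mp ⟨z, hz⟩
  have hM0 : 0 ≤ M := (norm_nonneg _).trans (hM c (mem_ball_self hr))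
  have hfc : DifferentiableAt ℂ f c := hf.differentiableAt (ball_mem_nhds c hr)
  let g : E → F := fun w => f w - fderiv ℂ f c (w - c)
  have hg_sub (w : E) : g w - g c = f w - f c - fderiv ℂ f c (w - c) := by
    simp only [g, sub_self, map_zero]
    abel
  have hg : DifferentiableOn ℂ g (ball c r) := hf.sub (by fun_prop)
  have hmaps : MapsTo g (ball c r) (closedBall (g c) (4 * M)) := by
    intro w hw
    have hlin : ‖fderiv ℂ f c (w - c)‖ ≤ 2 * M := by
      calc ‖fderiv ℂ f c (w - c)‖ ≤ ‖fderiv ℂ f c‖ * ‖w - c‖ := (fderiv ℂ f c).le_opNorm _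
        _ ≤ 2 * M / r * r := by
          gcongr
          · exact norm_fderiv_le_of_forall_mem_ball_norm_le hr hf hM
          · exact (mem_ball_iff_norm.mp hw).le
        _ = 2 * M := by field_simp
    rw [mem_closedBall, dist_eq_norm, hg_sub]
    linarith [norm_sub_le (f w - f c) (fderiv ℂ f c (w - c)), norm_sub_le (f w) (f c), hM w hw,
      hM c (mem_ball_self hr)]
  have hlo : (g · - g c) =o[𝓝 c] (fun w => ‖w - c‖ ^ 1) := by
    simp only [hg_sub, pow_one]
    exact hfc.hasFDerivAt.isLittleO.norm_right
  have hquad := Complex.dist_le_mul_div_pow_of_mapsTo_ball_of_isLittleO hg hmaps hlo hz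
  rwa [dist_eq_norm, hg_sub] at hquad

theorem hasDerivAt_comp_line {p u : E} {t : ℂ} (hf : DifferentiableAt ℂ f (p + t • u)) :
    HasDerivAt (fun s : ℂ => f (p + s • u)) (fderiv ℂ f (p + t • u) u) t :=
  hf.hasFDerivAt.comp_hasDerivAt t (by simpa using ((hasDerivAt_id t).smul_const u).const_add p)

theorem differentiableAt_comp_line {p u : E} {t : ℂ} (hf : DifferentiableAt ℂ f (p + t • u)) :
    DifferentiableAt ℂ (fun s : ℂ => f (p + s • u)) t :=
  (hasDerivAt_comp_line hf).differentiableAt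

variable [CompleteSpace F]

theorem eqOn_zero_ball_of_eventuallyEq_zero {q a : E} (hf : DifferentiableOn ℂ f (ball q (4 * r)))
    (ha : a ∈ ball q r) (h0 : f =ᶠ[𝓝 a] 0) : EqOn f 0 (ball q r) := by
  intro z hz
  have hmem : ∀ t ∈ ball (0 : ℂ) (3 / 2), a + t • (z - a) ∈ ball q (4 * r) := by
    intro t ht
    rw [mem_ball_zero_iff] at ht
    rw [mem_ball_iff_norm] at ha hz ⊢
    have hza : ‖t • (z - a)‖ ≤ 3 / 2 * (2 * r) := by
      rw [norm_smul]
      gcongr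
      linarith [norm_sub_le_norm_sub_add_norm_sub z q a, norm_sub_rev q a]
    rw [add_sub_right_comm]
    linarith [norm_add_le (a - q) (t • (z - a))]
  have hline : AnalyticOnNhd ℂ (fun t : ℂ => f (a + t • (z - a))) (ball 0 (3 / 2)) :=
    DifferentiableOn.analyticOnNhd (fun t ht => (differentiableAt_comp_line
      (hf.differentiableAt (isOpen_ball.mem_nhds (hmem t ht)))).differentiableWithinAt) isOpen_ball
  have hev : (fun t : ℂ => f (a + t • (z - a))) =ᶠ[𝓝 0] 0 := by
    have hcont : ContinuousAt (fun t : ℂ => a + t • (z - a)) 0 := by fun_prop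
    exact hcont.eventually (by simpa [EventuallyEq] using h0)
  have h1 := hline.eqOn_zero_of_preconnected_of_eventuallyEq_zero
    (convex_ball 0 (3 / 2)).isPreconnected (by simp) hev (show (1 : ℂ) ∈ _ by norm_num)
  simpa using h1

theorem eqOn_zero_of_preconnected_of_eventuallyEq_zero {X : Set E} (hX : IsOpen X)
    (hXc : IsPreconnected X) (hf : DifferentiableOn ℂ f X) {p : E} (hp : p ∈ X)
    (h0 : f =ᶠ[𝓝 p] 0) : EqOn f 0 X := by
  suffices hsub : X ⊆ {q | f =ᶠ[𝓝 q] 0} from fun z hz => (hsub hz).self_of_nhds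
  refine hXc.subset_of_closure_inter_subset isOpen_setOfPred_eventually_nhds ⟨p, hp, h0⟩ ?_
  rintro q ⟨hq, hqX⟩
  obtain ⟨r, hr, hball⟩ := Metric.isOpen_iff.mp hX q hqX
  obtain ⟨a, ha, haq⟩ := Metric.mem_closure_iff.mp hq (r / 4) (by positivity)
  have hfr : DifferentiableOn ℂ f (ball q (4 * (r / 4))) := by
    rw [mul_div_cancel₀ r four_ne_zero]
    exact hf.mono hball
  exact (eqOn_zero_ball_of_eventuallyEq_zero hfr (mem_ball'.mpr haq) ha).eventuallyEq_of_mem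
    (ball_mem_nhds q (by positivity))

theorem subset_closure_setOf_ne_zero {X : Set E} (hX : IsOpen X) (hXc : IsPreconnected X)
    (hf : DifferentiableOn ℂ f X) {p : E} (hp : p ∈ X) (hfp : f p ≠ 0) :
    X ⊆ closure {z ∈ X | f z ≠ 0} := by
  intro q hq
  by_contra hcl
  refine hfp (eqOn_zero_of_preconnected_of_eventuallyEq_zero hX hXc hf hq ?_ hp)
  filter_upwards [isClosed_closure.isOpen_compl.mem_nhds hcl, hX.mem_nhds hq] with z hz hzX
  by_contra hne
  exact hz (subset_closure ⟨hzX, hne⟩)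

end HolomorphicFunctions

section Polarization

variable {E : Type*} [NormedAddCommGroup E] [NormedSpace ℂ E]

theorem eqOn_zero_ball_of_forall_ofReal_eq_zero {f : ℂ → ℂ} {r : ℝ} (hr : 0 < r)
    (hf : DifferentiableOn ℂ f (ball 0 r)) (h0 : ∀ t : ℝ, |t| < r → f t = 0) :
    EqOn f 0 (ball 0 r) := by
  have hofReal : Tendsto ((↑) : ℝ → ℂ) (𝓝[≠] 0) (𝓝[≠] 0) :=
    (Complex.continuous_ofReal.tendsto' 0 0 Complex.ofReal_zero).inf
      (tendsto_principal_principal.mpr fun t ht => by simpa using ht)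
  have hfreq : ∃ᶠ z in 𝓝[≠] (0 : ℂ), f z = 0 := by
    refine hofReal.frequently (Eventually.frequently ?_)
    filter_upwards [mem_nhdsWithin_of_mem_nhds (ball_mem_nhds (0 : ℝ) hr)] with t ht
    exact h0 t (by simpa using ht)
  exact (hf.analyticOnNhd isOpen_ball).eqOn_zero_of_preconnected_of_frequently_eq_zero
    (convex_ball 0 r).isPreconnected (mem_ball_self hr) hfreq

/-- `Φ` is holomorphic in its first and antiholomorphic in its second variable, in the weak sense
which polarization requires: only the restrictions to the complex lines `t ↦ (m + t d, m + t̄ d)`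
are tested, so that no complex structure on the conjugate of `E` is needed. -/
def IsPolarizableOn (Φ : E → E → ℂ) (X : Set E) : Prop :=
  ∀ (m d : E) (t : ℂ), m + t • d ∈ X → m + conj t • d ∈ X →
    DifferentiableAt ℂ (fun s : ℂ => Φ (m + s • d) (m + conj s • d)) t

namespace IsPolarizableOn

variable {Φ Ψ : E → E → ℂ} {X Y : Set E}

theorem mono (hΦ : IsPolarizableOn Φ X) (hY : Y ⊆ X) : IsPolarizableOn Φ Y :=
  fun m d t h₁ h₂ => hΦ m d t (hY h₁) (hY h₂)

theorem const (a : ℂ) : IsPolarizableOn (fun _ _ => a) X :=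
  fun _ _ _ _ _ => differentiableAt_const a

theorem sub (hΦ : IsPolarizableOn Φ X) (hΨ : IsPolarizableOn Ψ X) :
    IsPolarizableOn (fun x y => Φ x y - Ψ x y) X :=
  fun m d t h₁ h₂ => (hΦ m d t h₁ h₂).sub (hΨ m d t h₁ h₂)

theorem mul (hΦ : IsPolarizableOn Φ X) (hΨ : IsPolarizableOn Ψ X) :
    IsPolarizableOn (fun x y => Φ x y * Ψ x y) X :=
  fun m d t h₁ h₂ => (hΦ m d t h₁ h₂).mul (hΨ m d t h₁ h₂)

theorem div (hΦ : IsPolarizableOn Φ X) (hΨ : IsPolarizableOn Ψ X)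
    (h0 : ∀ x ∈ X, ∀ y ∈ X, Ψ x y ≠ 0) : IsPolarizableOn (fun x y => Φ x y / Ψ x y) X :=
  fun m d t h₁ h₂ => (hΦ m d t h₁ h₂).div (hΨ m d t h₁ h₂) (h0 _ h₁ _ h₂)

/-- With `m = (x + y) / 2` and `d = (x - y) / 2i`, the line `t ↦ (m + t d, m + t̄ d)` runs in the
diagonal for real `t` and passes through `(x, y)` at `t = i`. -/
theorem eq_zero_of_forall_diag_eq_zero {p x y : E} {r : ℝ} (hΦ : IsPolarizableOn Φ (ball p (4 * r)))
    (h0 : ∀ z ∈ ball p (4 * r), Φ z z = 0) (hx : x ∈ ball p r) (hy : y ∈ ball p r) :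
    Φ x y = 0 := by
  let m : E := (1 / 2 : ℂ) • (x + y)
  let d : E := (-Complex.I / 2) • (x - y)
  have hmem : ∀ t ∈ ball (0 : ℂ) 2, m + t • d ∈ ball p (4 * r) := by
    intro t ht
    rw [mem_ball_zero_iff] at ht
    rw [mem_ball_iff_norm] at hx hy ⊢
    have hm : ‖(1 / 2 : ℂ) • ((x - p) + (y - p))‖ < r := by
      rw [norm_smul, norm_div, norm_one, Complex.norm_ofNat]
      linarith [norm_add_le (x - p) (y - p)]
    have hd : ‖t • d‖ ≤ 2 * r := by
      have hd' : ‖d‖ ≤ r := by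
        rw [norm_smul, norm_div, norm_neg, Complex.norm_I, Complex.norm_ofNat]
        linarith [norm_sub_le_norm_sub_add_norm_sub x p y, norm_sub_rev p y]
      rw [norm_smul]
      gcongr
    have hsplit : m + t • d - p = (1 / 2 : ℂ) • ((x - p) + (y - p)) + t • d := by
      simp only [m]
      module
    rw [hsplit]
    linarith [norm_add_le ((1 / 2 : ℂ) • ((x - p) + (y - p))) (t • d), (norm_nonneg _).trans_lt hm]
  have hconj {t : ℂ} (ht : t ∈ ball (0 : ℂ) 2) : conj t ∈ ball (0 : ℂ) 2 := by simpa using ht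
  have hzero := eqOn_zero_ball_of_forall_ofReal_eq_zero two_pos
    (f := fun t : ℂ => Φ (m + t • d) (m + conj t • d))
    (fun t ht => (hΦ m d t (hmem t ht) (hmem _ (hconj ht))).differentiableWithinAt)
    (fun t ht => by
      simp only [Complex.conj_ofReal]
      exact h0 _ (hmem t (by simpa using ht)))
  have hI : Complex.I • d = (1 / 2 : ℂ) • (x - y) := by
    rw [smul_smul, mul_div_assoc', mul_neg, Complex.I_mul_I, neg_neg]
  have hxI : m + Complex.I • d = x := by
    rw [hI]
    simp only [m]
    module
  have hyI : m + conj Complex.I • d = y := by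
    rw [Complex.conj_I, neg_smul, hI]
    simp only [m]
    module
  simpa only [hxI, hyI, Pi.zero_apply] using hzero (show Complex.I ∈ ball (0 : ℂ) 2 by simp)

theorem eq_zero_of_eventually_diag_eq_zero (hX : IsOpen X) (hXc : IsPreconnected X)
    (hΦ : IsPolarizableOn Φ X) (hΦd : ∀ y ∈ X, DifferentiableOn ℂ (fun x => Φ x y) X)
    (hconj : ∀ x y, conj (Φ x y) = Φ y x) {p x y : E} (hp : p ∈ X)
    (h0 : ∀ᶠ z in 𝓝 p, Φ z z = 0) (hx : x ∈ X) (hy : y ∈ X) : Φ x y = 0 := by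
  obtain ⟨r, hr, hball⟩ := Metric.mem_nhds_iff.mp (inter_mem h0 (hX.mem_nhds hp))
  have hr4 : 0 < r / 4 := by positivity
  rw [← mul_div_cancel₀ r four_ne_zero] at hball
  have hleft : ∀ b ∈ ball p (r / 4), ∀ a ∈ X, Φ a b = 0 := fun b hb a ha => by
    have hbX : b ∈ X := (hball (ball_subset_ball (by linarith) hb)).2
    refine eqOn_zero_of_preconnected_of_eventuallyEq_zero hX hXc (hΦd b hbX) hp ?_ ha
    filter_upwards [ball_mem_nhds p hr4] with z hz
    exact (hΦ.mono fun z hz => (hball hz).2).eq_zero_of_forall_diag_eq_zero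
      (fun z hz => (hball hz).1) hz hb
  rw [← hconj, map_eq_zero]
  refine eqOn_zero_of_preconnected_of_eventuallyEq_zero hX hXc (hΦd x hx) hp ?_ hy
  filter_upwards [ball_mem_nhds p hr4] with z hz
  rw [← hconj, hleft z hz x hx, map_zero, Pi.zero_apply]

end IsPolarizableOn

end Polarization

section Submean

theorem posLog_norm_le_circleAverage {f : ℂ → ℂ} {c : ℂ} {r : ℝ} (hr : 0 < r)
    (hf : AnalyticOnNhd ℂ f (closedBall c r)) :
    log⁺ ‖f c‖ ≤ circleAverage (fun z => log⁺ ‖f z‖) c r := by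
  rcases le_total ‖f c‖ 1 with h1 | h1
  · rw [(posLog_eq_zero_iff _).mpr (by rwa [abs_norm])]
    exact circleAverage_nonneg_of_nonneg fun _ _ => posLog_nonneg
  rw [← abs_of_pos hr] at hf
  have hne : f c ≠ 0 := norm_pos_iff.mp (one_pos.trans_le h1)
  have hmer : MeromorphicOn f (sphere c |r|) :=
    fun z hz => (hf z (sphere_subset_closedBall hz)).meromorphicAt
  have hzeros : 0 ≤ ∑ᶠ u, MeromorphicOn.divisor f (closedBall c |r|) u * log (r * ‖c - u‖⁻¹) := by
    refine finsum_nonneg fun u => ?_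
    by_cases hu : u ∈ closedBall c |r|
    · refine mul_nonneg (mod_cast MeromorphicOn.AnalyticOnNhd.divisor_nonneg hf u) ?_
      rcases eq_or_ne c u with rfl | hcu
      · simp
      · rw [abs_of_pos hr, mem_closedBall', dist_eq_norm] at hu
        refine log_nonneg ?_
        rwa [← div_eq_mul_inv, one_le_div (norm_pos_iff.mpr (sub_ne_zero.mpr hcu))]
    · rw [Function.locallyFinsuppWithin.apply_eq_zero_of_notMem _ hu, Int.cast_zero, zero_mul]
  calc log⁺ ‖f c‖ = log ‖f c‖ := posLog_eq_log (by rwa [abs_norm])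
    _ ≤ circleAverage (fun z => log ‖f z‖) c r := by
      rw [AnalyticOnNhd.circleAverage_log_norm hr.ne' hf hne]
      linarith
    _ ≤ circleAverage (fun z => log⁺ ‖f z‖) c r :=
      circleAverage_mono hmer.circleIntegrable_log_norm hmer.circleIntegrable_posLog_norm
        fun _ _ => le_max_right _ _

variable {ψ : ℂ → ℝ} {a ρ : ℝ}

theorem circleMap_zero_one_mul_mem_closedBall {z : ℂ} (hz : z ∈ closedBall (0 : ℂ) ρ) (θ : ℝ) :
    circleMap 0 1 θ * z ∈ closedBall (0 : ℂ) ρ := by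
  simpa using hz

theorem integrable_comp_circleMap_mul (hψ : ContinuousOn ψ (closedBall 0 ρ)) :
    Integrable (fun p : ℝ × ℂ => ψ (circleMap 0 1 p.1 * p.2))
      ((volume.restrict (uIoc 0 (2 * π))).prod (volume.restrict (closedBall 0 ρ))) := by
  rw [Measure.prod_restrict, ← Measure.volume_eq_prod]
  have hcont : ContinuousOn (fun p : ℝ × ℂ => ψ (circleMap 0 1 p.1 * p.2))
      (uIcc 0 (2 * π) ×ˢ closedBall 0 ρ) :=
    hψ.comp (by fun_prop) fun p hp => circleMap_zero_one_mul_mem_closedBall hp.2 p.1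
  exact (hcont.integrableOn_compact (isCompact_uIcc.prod (isCompact_closedBall 0 ρ))).mono_set
    (prod_mono uIoc_subset_uIcc Subset.rfl)

theorem setIntegral_closedBall_comp_circleMap_mul (ψ : ℂ → ℝ) (ρ θ : ℝ) :
    ∫ z in closedBall 0 ρ, ψ (circleMap 0 1 θ * z) = ∫ z in closedBall 0 ρ, ψ z := by
  let e : ℂ ≃ₗᵢ[ℝ] ℂ := rotation (Circle.exp θ)
  have he (z : ℂ) : e z = circleMap 0 1 θ * z := by simp [e, circleMap]
  have hpre : e ⁻¹' closedBall 0 ρ = closedBall 0 ρ := by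
    rw [e.preimage_closedBall, map_zero]
  simp only [← he]
  conv_lhs => rw [← hpre]
  exact e.measurePreserving.setIntegral_preimage_emb e.toHomeomorph.measurableEmbedding ψ _

theorem setIntegral_closedBall_circleAverage_mul (hψ : ContinuousOn ψ (closedBall 0 ρ)) :
    ∫ z in closedBall 0 ρ, circleAverage (fun w => ψ (w * z)) 0 1 = ∫ z in closedBall 0 ρ, ψ z := by
  simp only [circleAverage, smul_eq_mul]
  rw [integral_const_mul, ← intervalIntegral_integral_swap (integrable_comp_circleMap_mul hψ)]
  simp only [setIntegral_closedBall_comp_circleMap_mul, intervalIntegral.integral_const, sub_zero,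
    smul_eq_mul]
  field_simp

theorem mul_volume_closedBall_le_setIntegral (hψ : ContinuousOn ψ (closedBall 0 ρ))
    (ha : ∀ z ∈ closedBall (0 : ℂ) ρ, a ≤ circleAverage (fun w => ψ (w * z)) 0 1) :
    a * volume.real (closedBall (0 : ℂ) ρ) ≤ ∫ z in closedBall 0 ρ, ψ z := by
  have hint : IntegrableOn (fun z : ℂ => circleAverage (fun w => ψ (w * z)) 0 1)
      (closedBall 0 ρ) := by
    simp only [circleAverage, intervalIntegral.integral_of_le two_pi_pos.le, ← uIoc_of_le
      two_pi_pos.le]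
    exact (integrable_comp_circleMap_mul hψ).integral_prod_right.const_mul _
  rw [← setIntegral_closedBall_circleAverage_mul hψ, mul_comm, ← smul_eq_mul, ← setIntegral_const]
  exact setIntegral_mono_on (integrableOn_const measure_closedBall_lt_top.ne) hint
    measurableSet_closedBall ha

end Submean

section HartogsLemma

variable {c : ℂ} {r R : ℝ}

theorem eventually_forall_mem_closedBall_lt_of_submean {ψ : ℕ → ℂ → ℝ} {M ε : ℝ} (hr : 0 < r)
    (hψ : ∀ n, ContinuousOn (ψ n) (closedBall c (2 * r)))
    (h0 : ∀ n, ∀ z ∈ closedBall c (2 * r), 0 ≤ ψ n z)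
    (hM : ∀ n, ∀ z ∈ closedBall c (2 * r), ψ n z ≤ M)
    (hlim : ∀ z ∈ closedBall c (2 * r), Tendsto (ψ · z) atTop (𝓝 0))
    (hsub : ∀ n, ∀ z ∈ closedBall c r, ∀ u ∈ closedBall (0 : ℂ) r,
      ψ n z ≤ circleAverage (fun w => ψ n (z + w * u)) 0 1) (hε : 0 < ε) :
    ∀ᶠ n in atTop, ∀ z ∈ closedBall c r, ψ n z < ε := by
  have hV : 0 < volume.real (closedBall (0 : ℂ) r) :=
    ENNReal.toReal_pos (measure_closedBall_pos volume 0 hr).ne' measure_closedBall_lt_top.ne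
  have hintegral : Tendsto (fun n => ∫ z in closedBall c (2 * r), ψ n z) atTop (𝓝 0) := by
    have hdom := tendsto_integral_of_dominated_convergence (F := ψ)
      (μ := volume.restrict (closedBall c (2 * r))) (f := fun _ => 0) (fun _ => M)
      (fun n => (hψ n).aestronglyMeasurable measurableSet_closedBall)
      (integrableOn_const measure_closedBall_lt_top.ne)
      (fun n => ae_restrict_of_forall_mem measurableSet_closedBall fun z hz => by
        rw [Real.norm_of_nonneg (h0 n z hz)]
        exact hM n z hz)
      (ae_restrict_of_forall_mem measurableSet_closedBall hlim)
    simpa using hdom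
  filter_upwards [hintegral.eventually_lt_const (mul_pos hε hV)] with n hn z hz
  refine lt_of_mul_lt_mul_right (lt_of_le_of_lt ?_ hn) hV.le
  have hpre : (z + ·) ⁻¹' closedBall z r = closedBall 0 r := by
    rw [preimage_add_closedBall, sub_self]
  have hzr : closedBall z r ⊆ closedBall c (2 * r) :=
    closedBall_subset_closedBall' (by linarith [mem_closedBall.mp hz])
  calc ψ n z * volume.real (closedBall 0 r)
      ≤ ∫ u in closedBall 0 r, ψ n (z + u) :=
        mul_volume_closedBall_le_setIntegral
          ((hψ n).comp (by fun_prop) fun u hu => hzr (by rwa [← hpre] at hu)) (hsub n z hz)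
    _ = ∫ w in closedBall z r, ψ n w := by
        rw [← hpre]
        exact (measurePreserving_add_left volume z).setIntegral_preimage_emb
          (measurableEmbedding_addLeft z) (ψ n) _
    _ ≤ ∫ w in closedBall c (2 * r), ψ n w :=
        setIntegral_mono_set ((hψ n).integrableOn_compact (isCompact_closedBall c _))
          (ae_restrict_of_forall_mem measurableSet_closedBall (h0 n)) hzr.eventuallyLE

theorem posLog_norm_le_circleAverage_mul {f : ℂ → ℂ} {z u : ℂ}
    (hf : DifferentiableOn ℂ f (ball c R)) (hz : z ∈ closedBall c r) (hu : u ∈ closedBall 0 r)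
    (hR : 2 * r < R) : log⁺ ‖f z‖ ≤ circleAverage (fun w => log⁺ ‖f (z + w * u)‖) 0 1 := by
  have hmem : ∀ w ∈ closedBall (0 : ℂ) 1, z + w * u ∈ ball c R := by
    intro w hw
    rw [mem_closedBall_zero_iff] at hw hu
    rw [mem_closedBall_iff_norm] at hz
    rw [mem_ball_iff_norm, add_sub_right_comm]
    calc ‖z - c + w * u‖ ≤ ‖z - c‖ + ‖w * u‖ := norm_add_le _ _
      _ ≤ r + 1 * r := by
        rw [norm_mul]
        gcongr
      _ < R := by linarith
  have hline : AnalyticOnNhd ℂ (fun w => f (z + w * u)) (closedBall 0 1) := fun w hw =>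
    AnalyticAt.fun_comp (g := f) (hf.analyticAt (isOpen_ball.mem_nhds (hmem w hw))) (by fun_prop)
  simpa using posLog_norm_le_circleAverage one_pos hline

theorem inv_mul_posLog_le_of_le_mul_pow {x A B : ℝ} (hx : 0 ≤ x) {n : ℕ} (h : x ≤ A * B ^ n) :
    (n : ℝ)⁻¹ * log⁺ x ≤ log⁺ A + log⁺ B := by
  rcases n.eq_zero_or_pos with rfl | hn
  · simpa using add_nonneg posLog_nonneg posLog_nonneg
  have hn1 : (1 : ℝ) ≤ n := Nat.one_le_cast.mpr hn
  rw [inv_mul_le_iff₀ (by positivity)]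
  calc log⁺ x ≤ log⁺ (A * B ^ n) := posLog_le_posLog hx h
    _ ≤ log⁺ A + log⁺ (B ^ n) := posLog_mul
    _ ≤ n * log⁺ A + n * log⁺ B := by
      rw [posLog_pow]
      gcongr
      exact le_mul_of_one_le_left posLog_nonneg hn1
    _ = n * (log⁺ A + log⁺ B) := by ring

theorem le_pow_of_inv_mul_posLog_lt {x q : ℝ} {n : ℕ} (hx : 0 ≤ x) (hq : 1 < q) (hn : 0 < n)
    (h : (n : ℝ)⁻¹ * log⁺ x < log q) : x ≤ q ^ n := by
  rcases le_total x 1 with h1 | h1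
  · exact h1.trans (one_le_pow₀ hq.le)
  rw [inv_mul_lt_iff₀ (by positivity), posLog_eq_log (by rwa [abs_of_nonneg hx]),
    ← log_pow] at h
  exact (log_lt_log_iff (by positivity) (by positivity)).mp h |>.le

/-- Hartogs' lemma: the submean functions `log⁺ ‖f n‖ / n` are uniformly bounded and tend to `0`
pointwise, hence uniformly on a smaller disc. -/
theorem exists_forall_mem_closedBall_norm_le_mul_pow {f : ℕ → ℂ → ℂ} {A B q : ℝ} (hr : 0 < r)
    (hR : 2 * r < R) (hf : ∀ n, DifferentiableOn ℂ (f n) (ball c R))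
    (hAB : ∀ n, ∀ z ∈ ball c R, ‖f n z‖ ≤ A * B ^ n)
    (hbdd : ∀ z ∈ ball c R, ∃ C, ∀ n, ‖f n z‖ ≤ C) (hq : 1 < q) :
    ∃ C, ∀ n, ∀ z ∈ closedBall c r, ‖f n z‖ ≤ C * q ^ n := by
  have hsubset : closedBall c (2 * r) ⊆ ball c R := closedBall_subset_ball hR
  have hlim (z : ℂ) (hz : z ∈ ball c R) :
      Tendsto (fun n : ℕ => (n : ℝ)⁻¹ * log⁺ ‖f n z‖) atTop (𝓝 0) := by
    obtain ⟨C, hC⟩ := hbdd z hz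
    refine squeeze_zero (g := fun n : ℕ => (n : ℝ)⁻¹ * log⁺ C)
      (fun n => mul_nonneg (by positivity) posLog_nonneg) (fun n => ?_) ?_
    · exact mul_le_mul_of_nonneg_left (posLog_le_posLog (norm_nonneg _) (hC n)) (by positivity)
    · simpa using (tendsto_inv_atTop_nhds_zero_nat (𝕜 := ℝ)).mul_const (log⁺ C)
  have hunif := eventually_forall_mem_closedBall_lt_of_submean
    (ψ := fun n z => (n : ℝ)⁻¹ • log⁺ ‖f n z‖) hr
    (fun n => ((continuous_posLog.comp_continuousOn (hf n).continuousOn.norm).const_smul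
      (n : ℝ)⁻¹).mono hsubset)
    (fun n z _ => mul_nonneg (by positivity) posLog_nonneg)
    (fun n z hz => inv_mul_posLog_le_of_le_mul_pow (norm_nonneg _) (hAB n z (hsubset hz)))
    (fun z hz => hlim z (hsubset hz))
    (fun n z hz u hu => by
      rw [circleAverage_fun_smul]
      exact smul_le_smul_of_nonneg_left (posLog_norm_le_circleAverage_mul (hf n) hz hu hR)
        (by positivity))
    (log_pos hq)
  obtain ⟨n₀, hn₀⟩ := eventually_atTop.mp (hunif.and (eventually_gt_atTop 0))
  obtain ⟨M, hM⟩ := ((finite_lt_nat n₀).image fun n => A * B ^ n).bddAbove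
  refine ⟨max 1 M, fun n z hz => ?_⟩
  rcases lt_or_ge n n₀ with hn | hn
  · calc ‖f n z‖ ≤ A * B ^ n := hAB n z (hsubset (closedBall_subset_closedBall (by linarith) hz))
      _ ≤ max 1 M := (hM ⟨n, hn, rfl⟩).trans (le_max_right _ _)
      _ ≤ max 1 M * q ^ n := le_mul_of_one_le_right (by positivity) (one_le_pow₀ hq.le)
  · calc ‖f n z‖ ≤ q ^ n :=
          le_pow_of_inv_mul_posLog_lt (norm_nonneg _) hq (hn₀ n hn).2 ((hn₀ n hn).1 z hz)
      _ ≤ max 1 M * q ^ n := le_mul_of_one_le_left (by positivity) (le_max_left _ _)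

end HartogsLemma

section Hartogs

theorem exists_isOpen_forall_norm_le_of_forall_bounded {ι Y F : Type*} [TopologicalSpace Y]
    [BaireSpace Y] [SeminormedAddCommGroup F] {g : ι → Y → F} {U : Set Y} (hU : IsOpen U)
    (hUne : U.Nonempty) (hg : ∀ i, ContinuousOn (g i) U)
    (hbdd : ∀ y ∈ U, ∃ C : ℝ, ∀ i, ‖g i y‖ ≤ C) :
    ∃ V ⊆ U, IsOpen V ∧ V.Nonempty ∧ ∃ N : ℝ, ∀ i, ∀ y ∈ V, ‖g i y‖ ≤ N := by
  have : BaireSpace U := hU.baireSpace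
  have : Nonempty U := hUne.to_subtype
  let S : ℕ → Set U := fun N => ⋂ i, {y | ‖g i y‖ ≤ N}
  have hS (N : ℕ) : IsClosed (S N) :=
    isClosed_iInter fun i => isClosed_le (hg i).domRestrict.norm continuous_const
  have hcover : ⋃ N, S N = univ := by
    refine eq_univ_of_forall fun y => ?_
    obtain ⟨C, hC⟩ := hbdd y y.2
    obtain ⟨N, hN⟩ := exists_nat_ge C
    exact mem_iUnion.mpr ⟨N, mem_iInter.mpr fun i => (hC i).trans hN⟩
  obtain ⟨N, hN⟩ := nonempty_interior_of_iUnion_of_closed hS hcover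
  refine ⟨(↑) '' interior (S N), Subtype.coe_image_subset U _, hU.isOpenMap_subtype_val _
    isOpen_interior, hN.image _, N, ?_⟩
  rintro i _ ⟨y, hy, rfl⟩
  exact mem_iInter.mp (interior_subset hy) i

variable {F : Type*} [NormedAddCommGroup F] [NormedSpace ℂ F] {b : ℂ} {s N : ℝ}

theorem norm_slope_sub_deriv_le {f : ℂ → F} (hf : DifferentiableOn ℂ f (ball b s))
    (hN : ∀ y ∈ ball b s, ‖f y‖ ≤ N) {y : ℂ} (hy : y ∈ ball b s) (hyb : y ≠ b) :
    ‖slope f b y - deriv f b‖ ≤ 4 * N / s ^ 2 * ‖y - b‖ := by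
  have hpos : 0 < ‖y - b‖ := norm_pos_iff.mpr (sub_ne_zero.mpr hyb)
  have hslope : slope f b y - deriv f b = (y - b)⁻¹ • (f y - f b - fderiv ℂ f b (y - b)) := by
    rw [slope_def_module, fderiv_eq_smul_deriv, smul_sub _ (f y - f b),
      inv_smul_smul₀ (sub_ne_zero.mpr hyb)]
  rw [hslope, norm_smul, norm_inv, inv_mul_le_iff₀ hpos]
  calc ‖f y - f b - fderiv ℂ f b (y - b)‖ ≤ 4 * N * (dist y b / s) ^ 2 :=
        norm_sub_sub_fderiv_le_of_forall_mem_ball_norm_le hf hN hy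
    _ = ‖y - b‖ * (4 * N / s ^ 2 * ‖y - b‖) := by
        rw [dist_eq_norm]
        ring

variable [CompleteSpace F]

theorem norm_iteratedDeriv_div_factorial_le {f : ℂ → F} {ρ : ℝ}
    (hf : DifferentiableOn ℂ f (ball b s)) (hN : ∀ y ∈ ball b s, ‖f y‖ ≤ N) (hρ : 0 < ρ)
    (hρs : ρ < s) (n : ℕ) : ‖iteratedDeriv n f b‖ / n.factorial ≤ N * (ρ⁻¹) ^ n := by
  have hsub : closedBall b ρ ⊆ ball b s := closedBall_subset_ball hρs
  have hcauchy := Complex.norm_iteratedDeriv_le_of_forall_mem_sphere_norm_le n hρ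
    (hf.diffContOnCl_ball hsub) fun y hy => hN y (hsub (sphere_subset_closedBall hy))
  rw [div_le_iff₀ (by positivity)]
  refine hcauchy.trans_eq ?_
  rw [inv_pow, ← div_eq_mul_inv]
  ring

theorem norm_le_mul_inv_of_forall_norm_iteratedDeriv_le {f : ℂ → F} {C B : ℝ} {y : ℂ}
    (hf : DifferentiableOn ℂ f (ball b s)) (hB : 0 ≤ B)
    (hC : ∀ n : ℕ, ‖iteratedDeriv n f b‖ / n.factorial ≤ C * B ^ n) (hy : y ∈ ball b s)
    (hyB : B * ‖y - b‖ < 1) : ‖f y‖ ≤ C * (1 - B * ‖y - b‖)⁻¹ := by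
  rw [← (Complex.hasSum_taylorSeries_on_ball hf hy).tsum_eq]
  refine tsum_of_norm_bounded
    ((hasSum_geometric_of_lt_one (by positivity) hyB).mul_left C) fun n => ?_
  calc ‖(n.factorial : ℂ)⁻¹ • (y - b) ^ n • iteratedDeriv n f b‖
      = ‖iteratedDeriv n f b‖ / n.factorial * ‖y - b‖ ^ n := by
        rw [norm_smul, norm_smul, norm_inv, norm_pow, Complex.norm_natCast]
        ring
    _ ≤ C * B ^ n * ‖y - b‖ ^ n := by
        gcongr
        exact hC n
    _ = C * (B * ‖y - b‖) ^ n := by ring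

variable {g : ℂ → ℂ → F} {U : Set ℂ}

theorem differentiableOn_deriv_param (hU : IsOpen U) (hs : 0 < s)
    (hg₁ : ∀ y ∈ ball b s, DifferentiableOn ℂ (g · y) U)
    (hg₂ : ∀ x ∈ U, DifferentiableOn ℂ (g x) (ball b s))
    (hN : ∀ x ∈ U, ∀ y ∈ ball b s, ‖g x y‖ ≤ N) :
    DifferentiableOn ℂ (fun x => deriv (g x) b) U := by
  have hball : ∀ᶠ y in 𝓝[≠] b, y ∈ ball b s ∧ y ≠ b :=
    inter_mem (mem_nhdsWithin_of_mem_nhds (ball_mem_nhds b hs)) self_mem_nhdsWithin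
  have hlim : Tendsto (fun y => 4 * N / s ^ 2 * ‖y - b‖) (𝓝[≠] b) (𝓝 0) :=
    (Continuous.tendsto' (by fun_prop) _ _ (by simp)).mono_left nhdsWithin_le_nhds
  have hunif : TendstoUniformlyOn (fun y x => slope (g x) b y) (fun x => deriv (g x) b)
      (𝓝[≠] b) U := by
    rw [Metric.tendstoUniformlyOn_iff]
    intro ε hε
    filter_upwards [hlim.eventually_lt_const hε, hball] with y hyε hy x hx
    rw [dist_comm, dist_eq_norm]
    exact (norm_slope_sub_deriv_le (hg₂ x hx) (hN x hx) hy.1 hy.2).trans_lt hyε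
  refine hunif.tendstoLocallyUniformlyOn.differentiableOn ?_ hU
  filter_upwards [hball] with y hy
  simp only [slope_def_module]
  exact ((hg₁ y hy.1).sub (hg₁ b (mem_ball_self hs))).const_smul _

theorem differentiableOn_iteratedDeriv_param (hU : IsOpen U) (hs : 0 < s)
    (hg₁ : ∀ y ∈ ball b s, DifferentiableOn ℂ (g · y) U)
    (hg₂ : ∀ x ∈ U, DifferentiableOn ℂ (g x) (ball b s))
    (hN : ∀ x ∈ U, ∀ y ∈ ball b s, ‖g x y‖ ≤ N) (n : ℕ) :
    DifferentiableOn ℂ (fun x => iteratedDeriv n (g x) b) U := by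
  induction n generalizing g s N with
  | zero => simpa using hg₁ b (mem_ball_self hs)
  | succ n ih =>
    simp only [iteratedDeriv_succ']
    have hhalf {y : ℂ} (hy : y ∈ ball b (s / 2)) : ball y (s / 2) ⊆ ball b s :=
      ball_subset_ball' (by linarith [mem_ball.mp hy])
    refine ih (g := fun x => deriv (g x)) (N := 2 * N / (s / 2)) (half_pos hs) (fun y hy => ?_)
      (fun x hx => ?_) (fun x hx y hy => ?_)
    · exact differentiableOn_deriv_param hU (half_pos hs) (fun z hz => hg₁ z (hhalf hy hz))
        (fun x hx => (hg₂ x hx).mono (hhalf hy)) (fun x hx z hz => hN x hx z (hhalf hy hz))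
    · exact ((hg₂ x hx).deriv isOpen_ball).mono (ball_subset_ball (by linarith))
    · rw [norm_deriv_eq_norm_fderiv]
      exact norm_fderiv_le_of_forall_mem_ball_norm_le (half_pos hs) ((hg₂ x hx).mono (hhalf hy))
        fun z hz => hN x hx z (hhalf hy hz)

end Hartogs

section HartogsTheorem

variable {g : ℂ → ℂ → ℂ} {a b : ℂ} {r R s ρ₀ ρ N : ℝ}

/-- Hartogs' lemma applies to the normalized Taylor coefficients `x ↦ ∂ⁿg(x, b) ρ₁ⁿ / n!`, where
`ρ₀ < ρ₁ < ρ`. -/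
theorem exists_forall_norm_iteratedDeriv_div_factorial_le (hr : 0 < r) (hR : 2 * r < R)
    (hg₁ : ∀ y ∈ ball b ρ, DifferentiableOn ℂ (g · y) (ball a R))
    (hg₂ : ∀ x ∈ ball a R, DifferentiableOn ℂ (g x) (ball b ρ)) (hs : 0 < s) (hsρ : s ≤ ρ)
    (hN : ∀ x ∈ ball a R, ∀ y ∈ ball b s, ‖g x y‖ ≤ N) (hρ₀ : 0 < ρ₀) (hρ : ρ₀ < ρ) :
    ∃ C, ∀ x ∈ closedBall a r, ∀ n : ℕ,
      ‖iteratedDeriv n (g x) b‖ / n.factorial ≤ C * (ρ₀⁻¹) ^ n := by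
  obtain ⟨ρ₁, hρ₀₁, hρ₁⟩ := exists_between hρ
  obtain ⟨ρ₂, hρ₁₂, hρ₂⟩ := exists_between hρ₁
  have hρ₁pos : 0 < ρ₁ := hρ₀.trans hρ₀₁
  have hsub : ball b s ⊆ ball b ρ := ball_subset_ball hsρ
  let h : ℕ → ℂ → ℂ := fun n x => ((ρ₁ : ℂ) ^ n / n.factorial) * iteratedDeriv n (g x) b
  have hnorm (n : ℕ) (x : ℂ) : ‖h n x‖ = ‖iteratedDeriv n (g x) b‖ / n.factorial * ρ₁ ^ n := by
    simp only [h, norm_mul, norm_div, norm_pow, Complex.norm_natCast, Complex.norm_real,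
      Real.norm_of_nonneg hρ₁pos.le]
    ring
  have hh (n : ℕ) : DifferentiableOn ℂ (h n) (ball a R) :=
    (differentiableOn_iteratedDeriv_param isOpen_ball hs (fun y hy => hg₁ y (hsub hy))
      (fun x hx => (hg₂ x hx).mono hsub) hN n).const_mul _
  have hexp (n : ℕ) (x : ℂ) (hx : x ∈ ball a R) : ‖h n x‖ ≤ N * ((s / 2)⁻¹ * ρ₁) ^ n := by
    rw [hnorm, mul_pow, ← mul_assoc]
    gcongr
    exact norm_iteratedDeriv_div_factorial_le ((hg₂ x hx).mono hsub) (hN x hx) (half_pos hs)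
      (half_lt_self hs) n
  have hbdd (x : ℂ) (hx : x ∈ ball a R) : ∃ C, ∀ n, ‖h n x‖ ≤ C := by
    obtain ⟨C, hC⟩ := (isCompact_closedBall b ρ₂).exists_bound_of_continuousOn
      ((hg₂ x hx).continuousOn.mono (closedBall_subset_ball hρ₂))
    refine ⟨C, fun n => ?_⟩
    have hcauchy := norm_iteratedDeriv_div_factorial_le
      ((hg₂ x hx).mono (ball_subset_ball hρ₂.le)) (fun y hy => hC y (ball_subset_closedBall hy))
      hρ₁pos hρ₁₂ n
    rwa [inv_pow, ← div_eq_mul_inv, le_div_iff₀ (by positivity), ← hnorm] at hcauchy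
  obtain ⟨C, hC⟩ := exists_forall_mem_closedBall_norm_le_mul_pow hr hR hh hexp hbdd
    ((one_lt_div hρ₀).mpr hρ₀₁)
  refine ⟨C, fun x hx n => ?_⟩
  rw [← mul_le_mul_iff_of_pos_right (pow_pos hρ₁pos n), ← hnorm, mul_assoc, ← mul_pow,
    ← div_eq_inv_mul]
  exact hC n x hx

theorem exists_bound_of_bounded_on_small_ball (hr : 0 < r) (hR : 2 * r < R)
    (hg₁ : ∀ y ∈ ball b ρ, DifferentiableOn ℂ (g · y) (ball a R))
    (hg₂ : ∀ x ∈ ball a R, DifferentiableOn ℂ (g x) (ball b ρ)) (hs : 0 < s) (hsρ : s ≤ ρ)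
    (hN : ∀ x ∈ ball a R, ∀ y ∈ ball b s, ‖g x y‖ ≤ N) (hρ₀ : 0 < ρ₀) (hρ : ρ₀ < ρ) :
    ∃ C, ∀ x ∈ closedBall a r, ∀ y ∈ closedBall b ρ₀, ‖g x y‖ ≤ C := by
  obtain ⟨ρ₁, hρ₀₁, hρ₁⟩ := exists_between hρ
  have hρ₁pos : 0 < ρ₁ := hρ₀.trans hρ₀₁
  obtain ⟨C, hC⟩ :=
    exists_forall_norm_iteratedDeriv_div_factorial_le hr hR hg₁ hg₂ hs hsρ hN hρ₁pos hρ₁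
  have hC0 : 0 ≤ C := by
    have hC₀ := hC a (mem_closedBall_self hr.le) 0
    rw [pow_zero, mul_one] at hC₀
    exact le_trans (by positivity) hC₀
  have hratio : ρ₁⁻¹ * ρ₀ < 1 := by rwa [inv_mul_lt_iff₀ hρ₁pos, mul_one]
  refine ⟨C * (1 - ρ₁⁻¹ * ρ₀)⁻¹, fun x hx y hy => ?_⟩
  have hyρ : ρ₁⁻¹ * ‖y - b‖ ≤ ρ₁⁻¹ * ρ₀ := by
    gcongr
    exact mem_closedBall_iff_norm.mp hy
  calc ‖g x y‖ ≤ C * (1 - ρ₁⁻¹ * ‖y - b‖)⁻¹ :=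
        norm_le_mul_inv_of_forall_norm_iteratedDeriv_le
          (hg₂ x (closedBall_subset_ball (by linarith) hx)) (by positivity) (hC x hx)
          (closedBall_subset_ball hρ hy) (hyρ.trans_lt hratio)
    _ ≤ C * (1 - ρ₁⁻¹ * ρ₀)⁻¹ := by gcongr

theorem exists_bound_of_separately_differentiableOn (hR : 0 < R)
    (hg₁ : ∀ y ∈ ball b R, DifferentiableOn ℂ (g · y) (ball a R))
    (hg₂ : ∀ x ∈ ball a R, DifferentiableOn ℂ (g x) (ball b R)) :
    ∃ C, ∀ x ∈ closedBall a (R / 8), ∀ y ∈ closedBall b (R / 8), ‖g x y‖ ≤ C := by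
  have haR : closedBall a (R / 2) ⊆ ball a R := closedBall_subset_ball (by linarith)
  have hbR : ball b (R / 8) ⊆ ball b R := ball_subset_ball (by linarith)
  obtain ⟨V, hVb, hV, ⟨b', hb'⟩, N, hN⟩ := exists_isOpen_forall_norm_le_of_forall_bounded
    (g := fun x : closedBall a (R / 2) => g x) isOpen_ball
    (nonempty_ball.mpr (show 0 < R / 8 by positivity))
    (fun x => (hg₂ x (haR x.2)).continuousOn.mono hbR)
    (fun y hy => by
      obtain ⟨C, hC⟩ := (isCompact_closedBall a (R / 2)).exists_bound_of_continuousOn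
        ((hg₁ y (hbR hy)).continuousOn.mono haR)
      exact ⟨C, fun x => hC x x.2⟩)
  obtain ⟨ε, hε, hεV⟩ := Metric.isOpen_iff.mp hV b' hb'
  have hb'R : dist b' b < R / 8 := hVb hb'
  have hhalf : ball b' (R / 2) ⊆ ball b R := ball_subset_ball' (by linarith)
  obtain ⟨C, hC⟩ := exists_bound_of_bounded_on_small_ball (a := a) (b := b') (r := R / 8)
    (R := R / 2) (ρ₀ := R / 4) (ρ := R / 2) (s := min ε (R / 2)) (by positivity) (by linarith)
    (fun y hy => (hg₁ y (hhalf hy)).mono (ball_subset_closedBall.trans haR))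
    (fun x hx => (hg₂ x (haR (ball_subset_closedBall hx))).mono hhalf)
    (by positivity) (min_le_right _ _)
    (fun x hx y hy => hN ⟨x, ball_subset_closedBall hx⟩ y
      (hεV (ball_subset_ball (min_le_left _ _) hy)))
    (by positivity) (by linarith)
  refine ⟨C, fun x hx y hy => hC x hx y ?_⟩
  rw [mem_closedBall] at hy ⊢
  linarith [dist_triangle_right y b' b]

end HartogsTheorem

section DualInner

variable {F : Type*} [NormedAddCommGroup F] [InnerProductSpace ℂ F] [CompleteSpace F]

theorem dualInner_eq_apply (l m : StrongDual ℂ F) :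
    dualInner l m = l ((InnerProductSpace.toDual ℂ F).symm m) := by
  rw [dualInner, InnerProductSpace.toDual_symm_apply]

theorem dualInner_conj_symm (l m : StrongDual ℂ F) : conj (dualInner m l) = dualInner l m :=
  inner_conj_symm _ _

theorem dualInner_self (l : StrongDual ℂ F) : dualInner l l = (‖l‖ : ℂ) ^ 2 := by
  rw [dualInner, inner_self_eq_norm_sq_to_K, LinearIsometryEquiv.norm_map]
  rfl

theorem dualInner_self_ne_zero {l : StrongDual ℂ F} (hl : l ≠ 0) : dualInner l l ≠ 0 := by
  simpa [dualInner_self] using hl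

theorem norm_dualInner_le (l m : StrongDual ℂ F) : ‖dualInner l m‖ ≤ ‖l‖ * ‖m‖ := by
  simpa only [dualInner_eq_apply, LinearIsometryEquiv.norm_map] using
    l.le_opNorm ((InnerProductSpace.toDual ℂ F).symm m)

theorem dualInner_mul_dualInner_swap (l m : StrongDual ℂ F) :
    dualInner l m * dualInner m l = (‖dualInner l m‖ : ℂ) ^ 2 := by
  rw [← dualInner_conj_symm m l, Complex.mul_conj']

theorem dualInner_add_left (l m k : StrongDual ℂ F) :
    dualInner (l + m) k = dualInner l k + dualInner m k := by
  simp only [dualInner_eq_apply, add_apply]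

theorem dualInner_smul_left (a : ℂ) (l m : StrongDual ℂ F) :
    dualInner (a • l) m = a * dualInner l m := by
  simp only [dualInner_eq_apply, smul_apply, smul_eq_mul]

theorem dualInner_add_right (l m k : StrongDual ℂ F) :
    dualInner l (m + k) = dualInner l m + dualInner l k := by
  simp only [dualInner_eq_apply, map_add]

theorem dualInner_smul_right (a : ℂ) (l m : StrongDual ℂ F) :
    dualInner l (a • m) = conj a * dualInner l m := by
  simp only [dualInner_eq_apply, map_smulₛₗ, smul_eq_mul, RingHom.id_apply]

theorem continuous_dualInner :
    Continuous fun q : StrongDual ℂ F × StrongDual ℂ F => dualInner q.1 q.2 := by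
  simp only [dualInner]
  fun_prop

variable {E : Type*} [NormedAddCommGroup E] [NormedSpace ℂ E] {α G H : E → StrongDual ℂ F}
  {X : Set E} {x : E}

theorem differentiableAt_dualInner (hα : DifferentiableAt ℂ α x) (m : StrongDual ℂ F) :
    DifferentiableAt ℂ (fun z => dualInner (α z) m) x := by
  simp only [dualInner_eq_apply]
  exact hα.clm_apply (differentiableAt_const _)

theorem fderiv_dualInner (hα : DifferentiableAt ℂ α x) (m : StrongDual ℂ F) (u : E) :
    fderiv ℂ (fun z => dualInner (α z) m) x u = dualInner (fderiv ℂ α x u) m := by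
  simp only [dualInner_eq_apply]
  rw [fderiv_clm_apply hα (differentiableAt_const _)]
  simp

theorem hasDerivAt_dualInner {A : ℂ → StrongDual ℂ F} {t : ℂ} (hA : DifferentiableAt ℂ A t)
    (m : StrongDual ℂ F) : HasDerivAt (fun z => dualInner (A z) m) (dualInner (deriv A t) m) t := by
  simp only [dualInner_eq_apply]
  simpa using hA.hasDerivAt.clm_apply (hasDerivAt_const t _)

theorem isPolarizableOn_dualInner (hX : IsOpen X) (hG : DifferentiableOn ℂ G X)
    (hH : DifferentiableOn ℂ H X) : IsPolarizableOn (fun x y => dualInner (G x) (H y)) X := by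
  intro m d t h₁ h₂
  simp only [dualInner_eq_apply]
  have hGt := differentiableAt_comp_line (hG.differentiableAt (hX.mem_nhds h₁))
  have hHt := differentiableAt_comp_line (hH.differentiableAt (hX.mem_nhds h₂))
  have hconj := hHt.comp_semilinear₁ (starRingEnd ℂ)
    (InnerProductSpace.toDual ℂ F).symm.toContinuousLinearEquiv.toContinuousLinearMap
  rw [Complex.conj_conj] at hconj
  exact hGt.clm_apply hconj

end DualInner

section WeakHolomorphy

variable {E : Type*} [NormedAddCommGroup E] [NormedSpace ℂ E]

theorem opNorm_le_of_dense_submodule {F : Type*} [NormedAddCommGroup F] [NormedSpace ℂ F]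
    {S : Submodule ℂ F} (hS : Dense (S : Set F)) {l : StrongDual ℂ F} {C : ℝ} (hC : 0 ≤ C)
    (h : ∀ f ∈ S, ‖l f‖ ≤ C * ‖f‖) : ‖l‖ ≤ C := by
  have hclosed : IsClosed {f : F | ‖l f‖ ≤ C * ‖f‖} := isClosed_le (by fun_prop) (by fun_prop)
  exact l.opNorm_le_bound hC fun f => hclosed.closure_subset_iff.mpr h (hS f)

theorem exists_forall_fderiv_apply_eq {F : Type*} [NormedAddCommGroup F] [NormedSpace ℂ F]
    {S : Submodule ℂ F} (hS : Dense (S : Set F)) {κ : E → StrongDual ℂ F} {c : E} {r M : ℝ}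
    (hr : 0 < r) (hM : ∀ x ∈ ball c r, ‖κ x‖ ≤ M)
    (hd : ∀ f ∈ S, DifferentiableOn ℂ (fun x => κ x f) (ball c r)) :
    ∃ A : E →L[ℂ] StrongDual ℂ F, ∀ u, ∀ f ∈ S, A u f = fderiv ℂ (fun x => κ x f) c u := by
  have hdc (f : S) : DifferentiableAt ℂ (fun x => κ x f) c :=
    (hd f f.2).differentiableAt (ball_mem_nhds c hr)
  let B₀ : S →ₗ[ℂ] (E →L[ℂ] ℂ) :=
    { toFun f := fderiv ℂ (fun x => κ x f) c
      map_add' f g := by simpa using fderiv_fun_add (hdc f) (hdc g)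
      map_smul' a f := by simpa using fderiv_fun_const_smul (hdc f) a }
  let B : S →L[ℂ] (E →L[ℂ] ℂ) := B₀.mkContinuous (2 * M / r) fun f =>
    (norm_fderiv_le_of_forall_mem_ball_norm_le hr (hd f f.2) fun x hx =>
      (κ x).le_of_opNorm_le (hM x hx) f).trans_eq (by
        rw [Submodule.coe_norm]
        ring)
  have hdense : DenseRange S.subtypeL := by
    rwa [DenseRange, Submodule.coe_subtypeL, Submodule.coe_subtype, Subtype.range_coe]
  exact ⟨(B.extend S.subtypeL).flip, fun u f hf => DFunLike.congr_fun
    (B.extend_eq hdense isUniformEmbedding_subtype_val.isUniformInducing ⟨f, hf⟩) u⟩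

theorem differentiableAt_of_forall_mem_dense_submodule {F : Type*} [NormedAddCommGroup F]
    [NormedSpace ℂ F] {S : Submodule ℂ F} (hS : Dense (S : Set F)) {κ : E → StrongDual ℂ F} {c : E}
    {r M : ℝ} (hr : 0 < r) (hM : ∀ x ∈ ball c r, ‖κ x‖ ≤ M)
    (hd : ∀ f ∈ S, DifferentiableOn ℂ (fun x => κ x f) (ball c r)) :
    DifferentiableAt ℂ κ c := by
  have hM0 : 0 ≤ M := (norm_nonneg _).trans (hM c (mem_ball_self hr))
  obtain ⟨A, hA⟩ := exists_forall_fderiv_apply_eq hS hr hM hd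
  have hremainder : ∀ x ∈ ball c r, ‖κ x - κ c - A (x - c)‖ ≤ 4 * M / r ^ 2 * ‖‖x - c‖ ^ 2‖ := by
    refine fun x hx => opNorm_le_of_dense_submodule hS (by positivity) fun f hf => ?_
    calc ‖(κ x - κ c - A (x - c)) f‖
        = ‖κ x f - κ c f - fderiv ℂ (fun x => κ x f) c (x - c)‖ := by
          rw [sub_apply, sub_apply, hA _ f hf]
      _ ≤ 4 * (M * ‖f‖) * (dist x c / r) ^ 2 :=
          norm_sub_sub_fderiv_le_of_forall_mem_ball_norm_le (hd f hf)
            (fun y hy => (κ y).le_of_opNorm_le (hM y hy) f) hx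
      _ = 4 * M / r ^ 2 * ‖‖x - c‖ ^ 2‖ * ‖f‖ := by
          rw [dist_eq_norm, norm_pow, norm_norm]
          ring
  have hderiv : HasFDerivAt κ A c := by
    rw [hasFDerivAt_iff_isLittleO]
    refine Asymptotics.IsBigO.trans_isLittleO ?_ (Asymptotics.isLittleO_pow_sub_sub c one_lt_two)
    exact .of_bound _ (eventually_of_mem (ball_mem_nhds c hr) hremainder)
  exact hderiv.differentiableAt

theorem norm_le_of_forall_norm_eq_one {G : Type*} [NormedAddCommGroup G] [NormedSpace ℂ G]
    {h : E → G} {x u : E} {C : ℝ}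
    (hd : ∀ t ∈ closedBall (0 : ℂ) 1, DifferentiableAt ℂ h (x + t • u))
    (hC : ∀ t : ℂ, ‖t‖ = 1 → ‖h (x + t • u)‖ ≤ C) : ‖h x‖ ≤ C := by
  have hdiff : DiffContOnCl ℂ (fun t : ℂ => h (x + t • u)) (ball 0 1) := by
    refine DifferentiableOn.diffContOnCl fun t ht => ?_
    rw [closure_ball _ one_ne_zero] at ht
    exact (differentiableAt_comp_line (hd t ht)).differentiableWithinAt
  simpa using Complex.norm_le_of_forall_mem_frontier_norm_le isBounded_ball hdiff
    (fun t ht => hC t (by simpa [frontier_ball] using ht))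
    (subset_closure (mem_ball_self one_pos))

variable {F : Type*} [NormedAddCommGroup F] [InnerProductSpace ℂ F] [CompleteSpace F]

theorem exists_bound_of_isCompact_of_differentiableOn_dualInner {A : ℂ → StrongDual ℂ F}
    {U K : Set ℂ} (hU : IsOpen U)
    (hA : ∀ t ∈ U, DifferentiableOn ℂ (fun s => dualInner (A s) (A t)) U) (hK : IsCompact K)
    (hKU : K ⊆ U) : ∃ C, ∀ t ∈ K, ‖A t‖ ≤ C := by
  refine hK.induction_on (p := fun T => ∃ C, ∀ t ∈ T, ‖A t‖ ≤ C) ⟨0, by simp⟩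
    (fun S T hST ⟨C, hC⟩ => ⟨C, fun t ht => hC t (hST ht)⟩) ?_ fun t₀ ht₀ => ?_
  · rintro S T ⟨C, hC⟩ ⟨D, hD⟩
    exact ⟨max C D, fun t ht => ht.elim (fun h => (hC t h).trans (le_max_left C D))
      fun h => (hD t h).trans (le_max_right C D)⟩
  obtain ⟨R, hR, hRU⟩ := Metric.isOpen_iff.mp hU t₀ (hKU ht₀)
  have hconj {y : ℂ} {ρ : ℝ} (hy : y ∈ ball (conj t₀) ρ) : conj y ∈ ball t₀ ρ := by
    rwa [mem_ball, ← Complex.dist_conj_conj, Complex.conj_conj]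
  have hconjDiff : ∀ x ∈ ball t₀ R,
      DifferentiableOn ℂ (fun y => dualInner (A x) (A (conj y))) (ball (conj t₀) R) := by
    intro x hx y hy
    have hy' := ((hA x (hRU hx)).differentiableAt (hU.mem_nhds (hRU (hconj hy)))).conj_conj
    simpa only [Function.comp_def, dualInner_conj_symm, Complex.conj_conj] using
      hy'.differentiableWithinAt
  obtain ⟨C, hC⟩ := exists_bound_of_separately_differentiableOn (a := t₀) (b := conj t₀)
    (g := fun s t => dualInner (A s) (A (conj t))) hR
    (fun y hy => (hA _ (hRU (hconj hy))).mono hRU) hconjDiff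
  refine ⟨closedBall t₀ (R / 8), mem_nhdsWithin_of_mem_nhds
    (closedBall_mem_nhds _ (by positivity)), √C, fun t ht => Real.le_sqrt_of_sq_le ?_⟩
  simpa [dualInner_self] using hC t ht (conj t) (by rwa [mem_closedBall, Complex.dist_conj_conj])

/-- The span of the vectors which represent the functionals `κ y`, `y ∈ X`. -/
def representerSpan (κ : E → StrongDual ℂ F) (X : Set E) : Submodule ℂ F :=
  Submodule.span ℂ ((fun y => (InnerProductSpace.toDual ℂ F).symm (κ y)) '' X)

variable {κ : E → StrongDual ℂ F} {X : Set E} {p : E}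

theorem differentiableOn_apply_of_mem_representerSpan
    (hκ : ∀ y ∈ X, DifferentiableOn ℂ (fun x => dualInner (κ x) (κ y)) X) {f : F}
    (hf : f ∈ representerSpan κ X) : DifferentiableOn ℂ (fun x => κ x f) X := by
  induction hf using Submodule.span_induction with
  | mem f hf =>
    obtain ⟨y, hy, rfl⟩ := hf
    simpa only [dualInner_eq_apply] using hκ y hy
  | zero => simp
  | add f g _ _ hf hg => simpa using hf.fun_add hg
  | smul a f _ hf => simpa using hf.const_mul a

theorem exists_bound_closedBall_smul (hX : IsOpen X)
    (hκ : ∀ y ∈ X, DifferentiableOn ℂ (fun x => dualInner (κ x) (κ y)) X) {u : E}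
    (hu : ∀ t ∈ closedBall (0 : ℂ) 1, p + t • u ∈ X) :
    ∃ C, ∀ t ∈ closedBall (0 : ℂ) 1, ‖κ (p + t • u)‖ ≤ C :=
  exists_bound_of_isCompact_of_differentiableOn_dualInner (A := fun t => κ (p + t • u))
    (hX.preimage (by fun_prop : Continuous fun t : ℂ => p + t • u))
    (fun t ht s hs => (differentiableAt_comp_line (f := fun x => dualInner (κ x) (κ (p + t • u)))
      ((hκ _ ht).differentiableAt (hX.mem_nhds hs))).differentiableWithinAt)
    (isCompact_closedBall 0 1) hu

theorem exists_ball_forall_norm_apply_le [CompleteSpace E] (hX : IsOpen X)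
    (hκ : ∀ y ∈ X, DifferentiableOn ℂ (fun x => dualInner (κ x) (κ y)) X) {r : ℝ} (hr : 0 < r)
    (hball : ball p r ⊆ X) :
    ∃ u₀ ∈ ball (0 : E) r, ∃ ε > 0, ∃ N : ℝ, ∀ u ∈ ball u₀ ε, ∀ t ∈ closedBall (0 : ℂ) 1,
      ∀ f ∈ representerSpan κ X, ‖κ (p + t • u) f‖ ≤ N * ‖f‖ := by
  have hmem {u : E} (hu : u ∈ ball 0 r) {t : ℂ} (ht : t ∈ closedBall 0 1) : p + t • u ∈ X := by
    rw [mem_closedBall_zero_iff] at ht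
    rw [mem_ball_zero_iff] at hu
    refine hball ?_
    rw [mem_ball_iff_norm, add_sub_cancel_left, norm_smul]
    exact (mul_le_of_le_one_left (norm_nonneg u) ht).trans_lt hu
  obtain ⟨V, hVr, hV, ⟨u₀, hu₀⟩, N, hN⟩ := exists_isOpen_forall_norm_le_of_forall_bounded
    (g := fun (i : closedBall (0 : ℂ) 1 × representerSpan κ X) u =>
      κ (p + (i.1 : ℂ) • u) i.2 / (‖i.2‖ : ℂ))
    isOpen_ball (nonempty_ball.mpr hr)
    (fun i => ((differentiableOn_apply_of_mem_representerSpan hκ i.2.2).continuousOn.comp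
      (by fun_prop) fun u hu => hmem hu i.1.2).div_const _)
    (fun u hu => by
      obtain ⟨C, hC⟩ := exists_bound_closedBall_smul hX hκ fun t => hmem hu
      refine ⟨C, fun i => ?_⟩
      rw [norm_div, Complex.norm_real, norm_norm]
      exact (ContinuousLinearMap.ratio_le_opNorm _ _).trans (hC i.1 i.1.2))
  obtain ⟨ε, hε, hεV⟩ := Metric.isOpen_iff.mp hV u₀ hu₀
  refine ⟨u₀, hVr hu₀, ε, hε, N, fun u hu t ht f hf => ?_⟩
  obtain rfl | hf0 := eq_or_ne f 0
  · simp
  have hNf := hN ⟨⟨t, ht⟩, ⟨f, hf⟩⟩ u (hεV hu)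
  rw [norm_div, Complex.norm_real, norm_norm] at hNf
  exact (div_le_iff₀ (norm_pos_iff.mpr hf0)).mp hNf

/-- Every disc `{x + t u₀ : ‖t‖ ≤ 1}` with `x` near `p` has its boundary in the cone on which
`exists_ball_forall_norm_apply_le` bounds `κ`, so the maximum principle bounds `κ` at its centre. -/
theorem exists_ball_forall_norm_le [CompleteSpace E] (hX : IsOpen X)
    (hS : Dense (representerSpan κ X : Set F))
    (hκ : ∀ y ∈ X, DifferentiableOn ℂ (fun x => dualInner (κ x) (κ y)) X) (hp : p ∈ X) :
    ∃ r > 0, ∃ M, ball p r ⊆ X ∧ ∀ x ∈ ball p r, ‖κ x‖ ≤ M := by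
  obtain ⟨r, hr, hball⟩ := Metric.isOpen_iff.mp hX p hp
  obtain ⟨u₀, hu₀, ε, hε, N, hN⟩ := exists_ball_forall_norm_apply_le hX hκ hr hball
  rw [mem_ball_zero_iff] at hu₀
  refine ⟨min ε (r - ‖u₀‖), lt_min hε (sub_pos.mpr hu₀), max N 0,
    (ball_subset_ball ((min_le_right _ _).trans (sub_le_self _ (norm_nonneg _)))).trans hball,
    fun x hx => opNorm_le_of_dense_submodule hS (le_max_right N 0) fun f hf => ?_⟩
  obtain ⟨hxε, hxr⟩ := lt_min_iff.mp (mem_ball_iff_norm.mp hx)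
  refine norm_le_of_forall_norm_eq_one (h := fun x => κ x f) (u := u₀) (fun t ht => ?_)
    fun t ht => ?_
  · refine (differentiableOn_apply_of_mem_representerSpan hκ hf).differentiableAt
      (hX.mem_nhds (hball ?_))
    have htu : ‖t • u₀‖ ≤ ‖u₀‖ := by
      rw [norm_smul]
      exact mul_le_of_le_one_left (norm_nonneg _) (mem_closedBall_zero_iff.mp ht)
    rw [mem_ball_iff_norm, add_sub_right_comm]
    linarith [norm_add_le (x - p) (t • u₀)]
  · have ht0 : t ≠ 0 := norm_ne_zero_iff.mp (ht ▸ one_ne_zero)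
    have hline : x + t • u₀ = p + t • (u₀ + t⁻¹ • (x - p)) := by
      rw [smul_add, smul_inv_smul₀ ht0]
      abel
    have hdir : u₀ + t⁻¹ • (x - p) ∈ ball u₀ ε := by
      rwa [mem_ball_iff_norm, add_sub_cancel_left, norm_smul, norm_inv, ht, inv_one, one_mul]
    rw [hline]
    refine (hN _ hdir t (mem_closedBall_zero_iff.mpr ht.le) f hf).trans ?_
    gcongr
    exact le_max_left N 0

theorem differentiableOn_of_differentiableOn_dualInner [CompleteSpace E] (hX : IsOpen X)
    (hS : Dense (representerSpan κ X : Set F))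
    (hκ : ∀ y ∈ X, DifferentiableOn ℂ (fun x => dualInner (κ x) (κ y)) X) :
    DifferentiableOn ℂ κ X := by
  intro x hx
  obtain ⟨r, hr, M, hsub, hM⟩ := exists_ball_forall_norm_le hX hS hκ hx
  refine (differentiableAt_of_forall_mem_dense_submodule hS hr hM fun f hf =>
    ?_).differentiableWithinAt
  exact (differentiableOn_apply_of_mem_representerSpan hκ hf).mono hsub

end WeakHolomorphy

section RKHS

variable {n : ℕ} {X : Set (EuclideanSpace ℂ (Fin n))}

theorem extendZero_coe {V : Type*} [Zero V] (f : X → V) (x : X) : extendZero f x = f x :=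
  Subtype.val_injective.extend_apply f 0 x

theorem evalMap_apply {X : Type*} {F : Type*} [NormedAddCommGroup F] [InnerProductSpace ℂ F]
    [RKHS ℂ F X ℂ] (x : X) (f : F) : evalMap F x f = f x :=
  rfl

theorem toDual_symm_evalMap {X : Type*} {F : Type*} [NormedAddCommGroup F]
    [InnerProductSpace ℂ F] [CompleteSpace F] [RKHS ℂ F X ℂ] (x : X) :
    (InnerProductSpace.toDual ℂ F).symm (evalMap F x) = RKHS.kerFun F x 1 := by
  rw [LinearIsometryEquiv.symm_apply_eq]
  ext f
  rw [InnerProductSpace.toDual_apply_apply, RKHS.kerFun_inner, evalMap_apply]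
  simp

theorem dualInner_evalMap {X : Type*} {K : X → X → ℂ} [Fact (opKernel K).PosSemidef] (x y : X) :
    dualInner (evalMap (RKHS.OfKernel (opKernel K)) x) (evalMap (RKHS.OfKernel (opKernel K)) y) =
      K x y := by
  rw [dualInner_eq_apply, toDual_symm_evalMap, evalMap_apply, RKHS.kerFun_apply,
    RKHS.OfKernel.kernel_ofKernel]
  simp [opKernel]

theorem dense_representerSpan_evalMap {F : Type*} [NormedAddCommGroup F] [InnerProductSpace ℂ F]
    [CompleteSpace F] [RKHS ℂ F X ℂ] :
    Dense (representerSpan (extendZero (evalMap F)) X : Set F) := by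
  refine (Submodule.dense_iff_topologicalClosure_eq_top.mpr (RKHS.kerFun_dense F)).mono ?_
  refine Submodule.span_le.mpr ?_
  rintro _ ⟨x, v, rfl⟩
  have hv : RKHS.kerFun F x v = v • RKHS.kerFun F x 1 := by rw [← map_smul, smul_eq_mul, mul_one]
  rw [hv, ← toDual_symm_evalMap, ← extendZero_coe (evalMap F) x]
  exact Submodule.smul_mem _ _ (Submodule.subset_span ⟨x, x.2, rfl⟩)

theorem IsSesquiHolomorphic.differentiableOn_evalMap (hX : IsOpen X) {K : X → X → ℂ}
    [Fact (opKernel K).PosSemidef] (hK : IsSesquiHolomorphic K) :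
    DifferentiableOn ℂ (extendZero (evalMap (RKHS.OfKernel (opKernel K)))) X := by
  refine differentiableOn_of_differentiableOn_dualInner hX dense_representerSpan_evalMap
    fun y hy => (hK.1 ⟨y, hy⟩).congr fun x hx => ?_
  rw [extendZero_coe _ ⟨x, hx⟩, extendZero_coe _ ⟨x, hx⟩, extendZero_coe _ ⟨y, hy⟩,
    dualInner_evalMap]

theorem IsNondegenerate.extendZero_evalMap_ne_zero {K : X → X → ℂ}
    [Fact (opKernel K).PosSemidef] (hK : IsNondegenerate K) {x : EuclideanSpace ℂ (Fin n)}
    (hx : x ∈ X) : extendZero (evalMap (RKHS.OfKernel (opKernel K))) x ≠ 0 := by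
  intro h₀
  have hxx := dualInner_evalMap (K := K) ⟨x, hx⟩ ⟨x, hx⟩
  rw [← extendZero_coe (evalMap _) ⟨x, hx⟩, h₀, dualInner_self, norm_zero] at hxx
  exact (hK ⟨x, hx⟩).ne (by simpa using hxx)

end RKHS

section Rescaling

variable {Y : Type*} {K L : Y → Y → ℂ}

theorem IsRescaling.symm (h : IsRescaling K L) (hK : ∀ x, K x x ≠ 0) : IsRescaling L K := by
  obtain ⟨ω, hω⟩ := h
  have hω₀ : ∀ x, ω x ≠ 0 := fun x h₀ => hK x (by rw [hω, h₀, zero_mul, zero_mul])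
  refine ⟨fun x => (ω x)⁻¹, fun x y => ?_⟩
  have hx := hω₀ x
  have hy : conj (ω y) ≠ 0 := (map_ne_zero _).mpr (hω₀ y)
  rw [hω, map_inv₀]
  field_simp

theorem areRescalings_iff_isRescaling (hL : ∀ x, L x x ≠ 0) :
    AreRescalings K L ↔ IsRescaling K L :=
  ⟨fun h => h.elim (fun h => h.symm hL) id, Or.inr⟩

/-- The defect of `K` from being a rescaling of `L`, normalized at `p`: its vanishing says that `K`
is obtained from `L` by the factor `ω x = √(L p p / K p p) * (K x p / L x p)`, cleared of its
denominators. -/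
def rescalingDefect (K L : Y → Y → ℂ) (p x y : Y) : ℂ :=
  L x p * L p y * K x y * K p p - K x p * K p y * L x y * L p p

theorem conj_rescalingDefect (hK : ∀ x y, conj (K x y) = K y x) (hL : ∀ x y, conj (L x y) = L y x)
    (p x y : Y) : conj (rescalingDefect K L p x y) = rescalingDefect K L p y x := by
  simp only [rescalingDefect, map_sub, map_mul, hK, hL]
  ring

theorem exists_forall_eq_mul_of_rescalingDefect_eq_zero (hK : ∀ x y, conj (K x y) = K y x)
    (hL : ∀ x y, conj (L x y) = L y x) (hK₀ : IsNondegenerate K) (hL₀ : IsNondegenerate L) {p : Y}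
    (h : ∀ x y, rescalingDefect K L p x y = 0) :
    ∃ ω : Y → ℂ, ∀ x y, K x p ≠ 0 → K y p ≠ 0 → K x y = ω x * conj (ω y) * L x y := by
  have hKp := (hK₀ p).ne'
  have hLp := (hL₀ p).ne'
  have hL_ne : ∀ x, K x p ≠ 0 → L x p ≠ 0 := fun x hx hLx => by
    have hdiag := h x x
    rw [rescalingDefect, hLx, zero_mul, zero_mul, zero_mul, zero_sub, neg_eq_zero] at hdiag
    have hx' : K p x ≠ 0 := by rwa [← hK, map_ne_zero]
    exact mul_ne_zero (mul_ne_zero (mul_ne_zero hx hx') (hL₀ x).ne') hLp hdiag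
  obtain ⟨c, hc⟩ : ∃ c : ℂ, c * conj c = L p p / K p p := by
    have hpos := div_pos (Complex.pos_iff.mp (hL₀ p)).1 (Complex.pos_iff.mp (hK₀ p)).1
    refine ⟨√((L p p).re / (K p p).re), ?_⟩
    rw [Complex.conj_ofReal, ← Complex.ofReal_mul, Real.mul_self_sqrt hpos.le, Complex.ofReal_div,
      Complex.conj_eq_iff_re.mp (hL p p), Complex.conj_eq_iff_re.mp (hK p p)]
  refine ⟨fun x => c * (K x p / L x p), fun x y hx hy => ?_⟩
  have hLx := hL_ne x hx
  have hLy : L p y ≠ 0 := by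
    rw [← hL, map_ne_zero]
    exact hL_ne y hy
  have hxy := h x y
  rw [rescalingDefect] at hxy
  calc K x y = L p p / K p p * (K x p / L x p * (K p y / L p y)) * L x y := by
        field_simp
        linear_combination hxy
    _ = c * (K x p / L x p) * conj (c * (K y p / L y p)) * L x y := by
        rw [← hc, map_mul, map_div₀, hK, hL]
        ring

variable [TopologicalSpace Y]

theorem isRescaling_of_dense (hK : Continuous fun z : Y × Y => K z.1 z.2)
    (hL : Continuous fun z : Y × Y => L z.1 z.2) (hK₀ : ∀ x, K x x ≠ 0) (hL₀ : ∀ x, L x x ≠ 0)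
    {U : Set Y} (hU : Dense U) {ω : Y → ℂ}
    (h : ∀ x ∈ U, ∀ y ∈ U, K x y = ω x * conj (ω y) * L x y) : IsRescaling K L := by
  have hlim : ∀ x, Tendsto ω (𝓝[U] x) (𝓝 (extendFrom U ω x)) := by
    intro x
    obtain ⟨q, hLq, hq⟩ := hU.inter_open_nonempty {q | L x q ≠ 0}
      (isOpen_ne_fun (hL.comp (.prodMk_right x)) continuous_const) ⟨x, hL₀ x⟩
    have hωq : conj (ω q) ≠ 0 := fun h₀ => hK₀ q (by rw [h q hq q hq, h₀, mul_zero, zero_mul])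
    have hKt : Tendsto (fun z => K z q) (𝓝 x) (𝓝 (K x q)) := (hK.comp (.prodMk_left q)).tendsto x
    have hLt : Tendsto (fun z => L z q) (𝓝 x) (𝓝 (L x q)) := (hL.comp (.prodMk_left q)).tendsto x
    refine tendsto_extendFrom ⟨K x q / (conj (ω q) * L x q), Tendsto.congr' ?_
      ((hKt.div (hLt.const_mul _) (mul_ne_zero hωq hLq)).mono_left nhdsWithin_le_nhds)⟩
    filter_upwards [self_mem_nhdsWithin, mem_nhdsWithin_of_mem_nhds (hLt.eventually_ne hLq)]
      with z hz hLz
    rw [Pi.div_apply, h z hz q hq]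
    field_simp
  refine ⟨extendFrom U ω, fun x y => ?_⟩
  have := mem_closure_iff_nhdsWithin_neBot.mp (hU x)
  have := mem_closure_iff_nhdsWithin_neBot.mp (hU y)
  have hx := (hlim x).comp (tendsto_fst (g := 𝓝[U] y))
  have hy := (hlim y).comp (tendsto_snd (f := 𝓝[U] x))
  have hle : 𝓝[U] x ×ˢ 𝓝[U] y ≤ 𝓝 (x, y) := by
    rw [nhds_prod_eq]
    exact prod_mono nhdsWithin_le_nhds nhdsWithin_le_nhds
  refine tendsto_nhds_unique_of_eventuallyEq ((hK.tendsto (x, y)).mono_left hle)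
    ((hx.mul ((Complex.continuous_conj.tendsto _).comp hy)).mul
      ((hL.tendsto (x, y)).mono_left hle)) ?_
  filter_upwards [prod_mem_prod (self_mem_nhdsWithin : U ∈ 𝓝[U] x)
    (self_mem_nhdsWithin : U ∈ 𝓝[U] y)] with z hz using h _ hz.1 _ hz.2

theorem isRescaling_of_rescalingDefect_eq_zero (hKc : Continuous fun z : Y × Y => K z.1 z.2)
    (hLc : Continuous fun z : Y × Y => L z.1 z.2) (hK : ∀ x y, conj (K x y) = K y x)
    (hL : ∀ x y, conj (L x y) = L y x) (hK₀ : IsNondegenerate K) (hL₀ : IsNondegenerate L) {p : Y}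
    (hp : Dense {x | K x p ≠ 0}) (h : ∀ x y, rescalingDefect K L p x y = 0) : IsRescaling K L := by
  obtain ⟨ω, hω⟩ := exists_forall_eq_mul_of_rescalingDefect_eq_zero hK hL hK₀ hL₀ h
  exact isRescaling_of_dense hKc hLc (fun x => (hK₀ x).ne') (fun x => (hL₀ x).ne') hp
    fun x hx y hy => hω x y hx hy

end Rescaling

section GramKernel

variable {F₁ F₂ : Type*} [NormedAddCommGroup F₁] [InnerProductSpace ℂ F₁] [CompleteSpace F₁]
  [NormedAddCommGroup F₂] [InnerProductSpace ℂ F₂] [CompleteSpace F₂]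

/-- The Gram kernel `(x, y) ↦ ⟨α(x), α(y)⟩` of a map `α` into a dual Hilbert space. -/
noncomputable def gramKernel {Y : Type*} (α : Y → StrongDual ℂ F₁) (x y : Y) : ℂ :=
  dualInner (α x) (α y)

theorem conj_gramKernel {Y : Type*} (α : Y → StrongDual ℂ F₁) (x y : Y) :
    conj (gramKernel α x y) = gramKernel α y x :=
  dualInner_conj_symm _ _

theorem gramKernel_evalMap {Y : Type*} (K : Y → Y → ℂ) [Fact (opKernel K).PosSemidef] :
    gramKernel (evalMap (RKHS.OfKernel (opKernel K))) = K := by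
  ext x y
  rw [gramKernel, dualInner_evalMap]

theorem isNondegenerate_gramKernel {Y : Type*} {α : Y → StrongDual ℂ F₁} (hα : ∀ x, α x ≠ 0) :
    IsNondegenerate (gramKernel α) := by
  intro x
  have hpos : 0 < ‖α x‖ ^ 2 := pow_pos (norm_pos_iff.mpr (hα x)) 2
  rw [gramKernel, dualInner_self]
  exact_mod_cast hpos

theorem continuous_gramKernel {Y : Type*} [TopologicalSpace Y] {α : Y → StrongDual ℂ F₁}
    (hα : Continuous α) : Continuous fun z : Y × Y => gramKernel α z.1 z.2 :=
  continuous_dualInner.comp (hα.prodMap hα)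

variable {E : Type*} [NormedAddCommGroup E] [NormedSpace ℂ E] {X : Set E}
  {α : E → StrongDual ℂ F₁} {β : E → StrongDual ℂ F₂}

theorem differentiableOn_gramKernel (hα : DifferentiableOn ℂ α X) (y : E) :
    DifferentiableOn ℂ (fun x => gramKernel α x y) X := by
  simp only [gramKernel, dualInner_eq_apply]
  exact hα.clm_apply (differentiableOn_const _)

theorem isPolarizableOn_rescalingDefect_gramKernel (hX : IsOpen X) (hα : DifferentiableOn ℂ α X)
    (hβ : DifferentiableOn ℂ β X) (p : E) :
    IsPolarizableOn (rescalingDefect (gramKernel α) (gramKernel β) p) X := by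
  have hconst₁ := differentiableOn_const (𝕜 := ℂ) (s := X) (α p)
  have hconst₂ := differentiableOn_const (𝕜 := ℂ) (s := X) (β p)
  have hα₁ := (isPolarizableOn_dualInner hX hα hconst₁).mul
    (isPolarizableOn_dualInner hX hconst₁ hα)
  have hβ₁ := (isPolarizableOn_dualInner hX hβ hconst₂).mul
    (isPolarizableOn_dualInner hX hconst₂ hβ)
  exact ((hβ₁.mul (isPolarizableOn_dualInner hX hα hα)).mul (.const _)).sub
    ((hα₁.mul (isPolarizableOn_dualInner hX hβ hβ)).mul (.const _))

theorem differentiableOn_rescalingDefect_gramKernel (hα : DifferentiableOn ℂ α X)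
    (hβ : DifferentiableOn ℂ β X) (p y : E) :
    DifferentiableOn ℂ (fun x => rescalingDefect (gramKernel α) (gramKernel β) p x y) X := by
  have hα₁ := (differentiableOn_gramKernel hα p).mul_const (gramKernel α p y)
  have hβ₁ := (differentiableOn_gramKernel hβ p).mul_const (gramKernel β p y)
  exact ((hβ₁.mul (differentiableOn_gramKernel hα y)).mul_const _).sub
    ((hα₁.mul (differentiableOn_gramKernel hβ y)).mul_const _)

theorem isRescaling_gramKernel_of_eventually_rescalingDefect_eq_zero (hX : IsOpen X)
    (hXc : IsPreconnected X) (hα : DifferentiableOn ℂ α X) (hβ : DifferentiableOn ℂ β X)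
    (hα₀ : ∀ x ∈ X, α x ≠ 0) (hβ₀ : ∀ x ∈ X, β x ≠ 0) {p : E} (hp : p ∈ X)
    (h : ∀ᶠ x in 𝓝 p, rescalingDefect (gramKernel α) (gramKernel β) p x x = 0) :
    IsRescaling (gramKernel fun x : X => α x) (gramKernel fun x : X => β x) := by
  have hdense : Dense {x : X | dualInner (α x) (α p) ≠ 0} := by
    rw [Subtype.dense_iff]
    convert subset_closure_setOf_ne_zero hX hXc (differentiableOn_gramKernel hα p) hp
      (dualInner_self_ne_zero (hα₀ p hp)) using 2
    ext x
    simp [gramKernel, and_comm]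
  refine isRescaling_of_rescalingDefect_eq_zero (p := ⟨p, hp⟩)
    (continuous_gramKernel hα.continuousOn.domRestrict)
    (continuous_gramKernel hβ.continuousOn.domRestrict) (conj_gramKernel _) (conj_gramKernel _)
    (isNondegenerate_gramKernel fun x => hα₀ x x.2) (isNondegenerate_gramKernel fun x => hβ₀ x x.2)
    hdense fun x y => ?_
  exact (isPolarizableOn_rescalingDefect_gramKernel hX hα hβ p).eq_zero_of_eventually_diag_eq_zero
    hX hXc (fun y _ => differentiableOn_rescalingDefect_gramKernel hα hβ p y)
    (conj_rescalingDefect (conj_gramKernel α) (conj_gramKernel β) p) hp h x.2 y.2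

end GramKernel

section PolarizedMetric

variable {F₁ F₂ : Type*} [NormedAddCommGroup F₁] [InnerProductSpace ℂ F₁] [CompleteSpace F₁]
  [NormedAddCommGroup F₂] [InnerProductSpace ℂ F₂] [CompleteSpace F₂]

theorem fubiniStudy_eq (g f h : StrongDual ℂ F₁) :
    fubiniStudy g f h = 1 / dualInner g g * dualInner f h -
      1 / dualInner g g ^ 2 * (dualInner f g * dualInner g h) := by
  rw [fubiniStudy, dualInner_self]
  ring

variable {U : Set ℂ} {A : ℂ → StrongDual ℂ F₁} {B : ℂ → StrongDual ℂ F₂} {c s t : ℂ}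

/-- The polarization of the Fubini-Study metric pulled back along the holomorphic curve `A`, that
is, `∂_s ∂_t̄ log ⟨A(s), A(t)⟩`. -/
noncomputable def polarizedMetric (A : ℂ → StrongDual ℂ F₁) (s t : ℂ) : ℂ :=
  (dualInner (deriv A s) (deriv A t) * dualInner (A s) (A t) -
    dualInner (A s) (deriv A t) * dualInner (deriv A s) (A t)) /
      (dualInner (A s) (A t) * dualInner (A s) (A t))

theorem polarizedMetric_self (h : dualInner (A s) (A s) ≠ 0) :
    polarizedMetric A s s = fubiniStudy (A s) (deriv A s) (deriv A s) := by
  rw [polarizedMetric, fubiniStudy_eq]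
  field_simp

theorem isPolarizableOn_polarizedMetric (hU : IsOpen U) (hA : DifferentiableOn ℂ A U)
    (hA₀ : ∀ s ∈ U, ∀ t ∈ U, dualInner (A s) (A t) ≠ 0) :
    IsPolarizableOn (polarizedMetric A) U := by
  have hA' := hA.deriv hU
  have hAA := isPolarizableOn_dualInner hU hA hA
  exact (((isPolarizableOn_dualInner hU hA' hA').mul hAA).sub
    ((isPolarizableOn_dualInner hU hA hA').mul (isPolarizableOn_dualInner hU hA' hA))).div
      (hAA.mul hAA) fun s hs t ht => mul_ne_zero (hA₀ s hs t ht) (hA₀ s hs t ht)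

theorem polarizedMetric_eq_of_fubiniStudy_eq {R : ℝ} (hA : DifferentiableOn ℂ A (ball c (4 * R)))
    (hB : DifferentiableOn ℂ B (ball c (4 * R)))
    (hA₀ : ∀ s ∈ ball c (4 * R), ∀ t ∈ ball c (4 * R), dualInner (A s) (A t) ≠ 0)
    (hB₀ : ∀ s ∈ ball c (4 * R), ∀ t ∈ ball c (4 * R), dualInner (B s) (B t) ≠ 0)
    (hAB : ∀ s ∈ ball c (4 * R), fubiniStudy (A s) (deriv A s) (deriv A s) =
      fubiniStudy (B s) (deriv B s) (deriv B s)) (hs : s ∈ ball c R) (ht : t ∈ ball c R) :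
    polarizedMetric A s t = polarizedMetric B s t := by
  refine sub_eq_zero.mp (((isPolarizableOn_polarizedMetric isOpen_ball hA hA₀).sub
    (isPolarizableOn_polarizedMetric isOpen_ball hB hB₀)).eq_zero_of_forall_diag_eq_zero
      (fun z hz => ?_) hs ht)
  rw [polarizedMetric_self (hA₀ z hz z hz), polarizedMetric_self (hB₀ z hz z hz), hAB z hz,
    sub_self]

theorem hasDerivAt_dualInner_div (hA : DifferentiableAt ℂ A s) (h : dualInner (A s) (A t) ≠ 0) :
    HasDerivAt (fun z => dualInner (A z) (deriv A t) / dualInner (A z) (A t))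
      (polarizedMetric A s t) s := by
  rw [polarizedMetric, ← sq]
  exact (hasDerivAt_dualInner hA (deriv A t)).div (hasDerivAt_dualInner hA (A t)) h

theorem logDeriv_gramKernel (hA : DifferentiableAt ℂ A t) (s : ℂ) :
    logDeriv (fun z => gramKernel A z s) t =
      conj (dualInner (A s) (deriv A t) / dualInner (A s) (A t)) := by
  rw [logDeriv_apply, map_div₀, dualInner_conj_symm, dualInner_conj_symm]
  exact congrArg (· / gramKernel A t s) (hasDerivAt_dualInner hA (A s)).deriv

theorem logDeriv_gramKernel_sub_eq (hU : IsOpen U) (hUc : IsPreconnected U)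
    (hA : DifferentiableOn ℂ A U) (hB : DifferentiableOn ℂ B U)
    (hA₀ : ∀ s ∈ U, ∀ t ∈ U, dualInner (A s) (A t) ≠ 0)
    (hB₀ : ∀ s ∈ U, ∀ t ∈ U, dualInner (B s) (B t) ≠ 0)
    (hAB : ∀ s ∈ U, ∀ t ∈ U, polarizedMetric A s t = polarizedMetric B s t) (hc : c ∈ U)
    (hs : s ∈ U) (ht : t ∈ U) :
    logDeriv (fun z => gramKernel A z s) t - logDeriv (fun z => gramKernel A z c) t =
      logDeriv (fun z => gramKernel B z s) t - logDeriv (fun z => gramKernel B z c) t := by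
  have hdA := fun z hz => hA.differentiableAt (hU.mem_nhds (x := z) hz)
  have hdB := fun z hz => hB.differentiableAt (hU.mem_nhds (x := z) hz)
  have hA' := fun z hz => hasDerivAt_dualInner_div (hdA z hz) (hA₀ z hz t ht)
  have hB' := fun z hz => hasDerivAt_dualInner_div (hdB z hz) (hB₀ z hz t ht)
  obtain ⟨a, ha⟩ := hU.exists_eq_add_of_deriv_eq hUc
    (fun z hz => (hA' z hz).differentiableAt.differentiableWithinAt)
    (fun z hz => (hB' z hz).differentiableAt.differentiableWithinAt)
    fun z hz => by rw [(hA' z hz).deriv, (hB' z hz).deriv, hAB z hz t ht]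
  rw [logDeriv_gramKernel (hdA t ht), logDeriv_gramKernel (hdA t ht),
    logDeriv_gramKernel (hdB t ht), logDeriv_gramKernel (hdB t ht), ← map_sub, ← map_sub]
  have has := ha hs
  have hac := ha hc
  simp only at has hac
  rw [has, hac, add_sub_add_right_eq_sub]

theorem rescalingDefect_eq_zero_of_polarizedMetric_eq (hU : IsOpen U) (hUc : IsPreconnected U)
    (hA : DifferentiableOn ℂ A U) (hB : DifferentiableOn ℂ B U)
    (hA₀ : ∀ s ∈ U, ∀ t ∈ U, dualInner (A s) (A t) ≠ 0)
    (hB₀ : ∀ s ∈ U, ∀ t ∈ U, dualInner (B s) (B t) ≠ 0)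
    (hAB : ∀ s ∈ U, ∀ t ∈ U, polarizedMetric A s t = polarizedMetric B s t) (hc : c ∈ U)
    (hs : s ∈ U) : rescalingDefect (gramKernel A) (gramKernel B) c s s = 0 := by
  have hdA := differentiableOn_gramKernel hA
  have hdB := differentiableOn_gramKernel hB
  have hdA' := fun w z hz => (hdA w).differentiableAt (hU.mem_nhds (x := z) hz)
  have hdB' := fun w z hz => (hdB w).differentiableAt (hU.mem_nhds (x := z) hz)
  have hlog : EqOn (logDeriv fun z => gramKernel A z s * gramKernel B z c)
      (logDeriv fun z => gramKernel B z s * gramKernel A z c) U := fun z hz => by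
    rw [logDeriv_mul z (hA₀ z hz s hs) (hB₀ z hz c hc) (hdA' s z hz) (hdB' c z hz),
      logDeriv_mul z (hB₀ z hz s hs) (hA₀ z hz c hc) (hdB' s z hz) (hdA' c z hz)]
    linear_combination logDeriv_gramKernel_sub_eq hU hUc hA hB hA₀ hB₀ hAB hc hs hz
  obtain ⟨a, -, ha⟩ := (logDeriv_eqOn_iff ((hdA s).mul (hdB c)) ((hdB s).mul (hdA c)) hU hUc
    (fun z hz => mul_ne_zero (hB₀ z hz s hs) (hA₀ z hz c hc))
    fun z hz => mul_ne_zero (hA₀ z hz s hs) (hB₀ z hz c hc)).mp hlog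
  have has := ha hs
  have hac := ha hc
  simp only [Pi.smul_apply, Pi.mul_apply, smul_eq_mul] at has hac
  rw [rescalingDefect]
  linear_combination
    gramKernel B c s * gramKernel A c c * has - gramKernel B s s * gramKernel A s c * hac

theorem rescalingDefect_eq_zero_of_fubiniStudy_eq {R : ℝ}
    (hA : DifferentiableOn ℂ A (ball c (4 * R))) (hB : DifferentiableOn ℂ B (ball c (4 * R)))
    (hA₀ : ∀ s ∈ ball c (4 * R), ∀ t ∈ ball c (4 * R), dualInner (A s) (A t) ≠ 0)
    (hB₀ : ∀ s ∈ ball c (4 * R), ∀ t ∈ ball c (4 * R), dualInner (B s) (B t) ≠ 0)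
    (hAB : ∀ s ∈ ball c (4 * R), fubiniStudy (A s) (deriv A s) (deriv A s) =
      fubiniStudy (B s) (deriv B s) (deriv B s)) (hs : s ∈ ball c R) :
    rescalingDefect (gramKernel A) (gramKernel B) c s s = 0 := by
  have hR : 0 < R := nonempty_ball.mp ⟨s, hs⟩
  have hsub : ball c R ⊆ ball c (4 * R) := ball_subset_ball (by linarith)
  exact rescalingDefect_eq_zero_of_polarizedMetric_eq isOpen_ball (convex_ball c R).isPreconnected
    (hA.mono hsub) (hB.mono hsub) (fun s hs t ht => hA₀ s (hsub hs) t (hsub ht))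
    (fun s hs t ht => hB₀ s (hsub hs) t (hsub ht))
    (fun s hs t ht => polarizedMetric_eq_of_fubiniStudy_eq hA hB hA₀ hB₀ hAB hs ht)
    (mem_ball_self hR) hs

theorem exists_mem_nhds_forall_dualInner_ne_zero {Y : Type*} [TopologicalSpace Y]
    {α : Y → StrongDual ℂ F₁} {p : Y} (hα : ContinuousAt α p) (hp : α p ≠ 0) :
    ∃ V ∈ 𝓝 p, ∀ x ∈ V, ∀ y ∈ V, dualInner (α x) (α y) ≠ 0 := by
  have hcont : ContinuousAt (fun z : Y × Y => dualInner (α z.1) (α z.2)) (p, p) :=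
    continuous_dualInner.continuousAt.comp (hα.prodMap' hα)
  have hne := hcont.eventually_ne (dualInner_self_ne_zero hp)
  rwa [nhds_prod_eq, eventually_prod_self_iff'] at hne

variable {E : Type*} [NormedAddCommGroup E] [NormedSpace ℂ E] {X : Set E}
  {α : E → StrongDual ℂ F₁} {β : E → StrongDual ℂ F₂} {p : E}

theorem eventually_rescalingDefect_eq_zero_of_fubiniStudy_eq (hX : IsOpen X)
    (hα : DifferentiableOn ℂ α X) (hβ : DifferentiableOn ℂ β X) (hp : p ∈ X) (hαp : α p ≠ 0)
    (hβp : β p ≠ 0)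
    (hαβ : ∀ x ∈ X, ∀ u, fubiniStudy (α x) (fderiv ℂ α x u) (fderiv ℂ α x u) =
      fubiniStudy (β x) (fderiv ℂ β x u) (fderiv ℂ β x u)) :
    ∀ᶠ x in 𝓝 p, rescalingDefect (gramKernel α) (gramKernel β) p x x = 0 := by
  obtain ⟨V, hV, hαV⟩ := exists_mem_nhds_forall_dualInner_ne_zero
    (hα.differentiableAt (hX.mem_nhds hp)).continuousAt hαp
  obtain ⟨W, hW, hβW⟩ := exists_mem_nhds_forall_dualInner_ne_zero
    (hβ.differentiableAt (hX.mem_nhds hp)).continuousAt hβp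
  obtain ⟨r, hr, hball⟩ := Metric.mem_nhds_iff.mp (inter_mem (inter_mem hV hW) (hX.mem_nhds hp))
  filter_upwards [ball_mem_nhds p (show 0 < r / 8 by positivity)] with x hx
  have hmem : ∀ s ∈ ball (0 : ℂ) (4 * 2), p + s • (x - p) ∈ V ∩ W ∩ X := fun s hs => hball <| by
    rw [mem_ball_iff_norm] at hx
    rw [mem_ball_zero_iff] at hs
    rw [mem_ball_iff_norm, add_sub_cancel_left, norm_smul]
    nlinarith [norm_nonneg s, norm_nonneg (x - p)]
  have hA := fun s hs => hasDerivAt_comp_line (hα.differentiableAt (hX.mem_nhds (hmem s hs).2))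
  have hB := fun s hs => hasDerivAt_comp_line (hβ.differentiableAt (hX.mem_nhds (hmem s hs).2))
  have hdefect := rescalingDefect_eq_zero_of_fubiniStudy_eq (c := 0) (s := 1)
    (fun s hs => (hA s hs).differentiableAt.differentiableWithinAt)
    (fun s hs => (hB s hs).differentiableAt.differentiableWithinAt)
    (fun s hs t ht => hαV _ (hmem s hs).1.1 _ (hmem t ht).1.1)
    (fun s hs t ht => hβW _ (hmem s hs).1.2 _ (hmem t ht).1.2)
    (fun s hs => by rw [(hA s hs).deriv, (hB s hs).deriv, hαβ _ (hmem s hs).2]) (by simp)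
  simpa [rescalingDefect, gramKernel] using hdefect

end PolarizedMetric

section RescalingInvariance

variable {F₁ F₂ : Type*} [NormedAddCommGroup F₁] [InnerProductSpace ℂ F₁] [CompleteSpace F₁]
  [NormedAddCommGroup F₂] [InnerProductSpace ℂ F₂] [CompleteSpace F₂]

theorem fubiniStudy_smul {g f h : StrongDual ℂ F₁} (hg : g ≠ 0) {a : ℂ} (ha : a ≠ 0) (b c : ℂ) :
    fubiniStudy (a • g) (a • f + b • g) (a • h + c • g) = fubiniStudy g f h := by
  have hg' := dualInner_self_ne_zero hg
  have ha' : conj a ≠ 0 := (map_ne_zero _).mpr ha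
  simp only [fubiniStudy_eq, dualInner_add_left, dualInner_smul_left, dualInner_add_right,
    dualInner_smul_right]
  field_simp
  ring

variable {E : Type*} [NormedAddCommGroup E] [NormedSpace ℂ E] {X : Set E}
  {α : E → StrongDual ℂ F₁} {β : E → StrongDual ℂ F₂} {ω : E → ℂ} {p : E}

theorem fubiniStudy_fderiv_eq_of_gramKernel_eq (hα : DifferentiableAt ℂ α p)
    (hβ : DifferentiableAt ℂ β p)
    (h : ∀ᶠ y in 𝓝 p, ∀ᶠ x in 𝓝 p, gramKernel α x y = gramKernel β x y) (u v : E) :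
    fubiniStudy (α p) (fderiv ℂ α p u) (fderiv ℂ α p v) =
      fubiniStudy (β p) (fderiv ℂ β p u) (fderiv ℂ β p v) := by
  have hleft : ∀ u, ∀ᶠ y in 𝓝 p,
      dualInner (fderiv ℂ α p u) (α y) = dualInner (fderiv ℂ β p u) (β y) := by
    intro u
    filter_upwards [h] with y hy
    rw [← fderiv_dualInner hα, ← fderiv_dualInner hβ]
    exact DFunLike.congr_fun (EventuallyEq.fderiv_eq (𝕜 := ℂ) hy) u
  have hright : ∀ u, ∀ᶠ x in 𝓝 p,
      dualInner (α x) (fderiv ℂ α p u) = dualInner (β x) (fderiv ℂ β p u) := by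
    intro u
    filter_upwards [hleft u] with x hx
    rw [← dualInner_conj_symm, hx, dualInner_conj_symm]
  have hboth : dualInner (fderiv ℂ α p u) (fderiv ℂ α p v) =
      dualInner (fderiv ℂ β p u) (fderiv ℂ β p v) := by
    rw [← fderiv_dualInner hα, ← fderiv_dualInner hβ]
    exact DFunLike.congr_fun (EventuallyEq.fderiv_eq (𝕜 := ℂ) (hright v)) u
  have hself : dualInner (α p) (α p) = dualInner (β p) (β p) := h.self_of_nhds.self_of_nhds
  rw [fubiniStudy_eq, fubiniStudy_eq, hboth, hself, (hleft u).self_of_nhds,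
    (hright v).self_of_nhds]

theorem differentiableAt_of_gramKernel_eq (hα : DifferentiableAt ℂ α p)
    (hβ : DifferentiableAt ℂ β p) (hω₀ : ω p ≠ 0) (hβ₀ : β p ≠ 0)
    (hω : ∀ᶠ x in 𝓝 p, gramKernel α x p = ω x * conj (ω p) * gramKernel β x p) :
    DifferentiableAt ℂ ω p := by
  have hω₀' : conj (ω p) ≠ 0 := (map_ne_zero _).mpr hω₀
  have hβp := dualInner_self_ne_zero hβ₀
  have hdβ := differentiableAt_dualInner hβ (β p)
  refine ((differentiableAt_dualInner hα (α p)).mul ((hdβ.const_mul (conj (ω p))).inv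
    (mul_ne_zero hω₀' hβp))).congr_of_eventuallyEq ?_
  filter_upwards [hω, hdβ.continuousAt.eventually_ne hβp] with x hx hxne
  simp only [gramKernel] at hx
  rw [Pi.mul_apply, Pi.inv_apply, hx]
  field_simp

theorem fubiniStudy_fderiv_eq_of_gramKernel_eq_mul (hα : DifferentiableAt ℂ α p)
    (hβ : DifferentiableAt ℂ β p) (hω₀ : ω p ≠ 0) (hβ₀ : β p ≠ 0)
    (hω : ∀ᶠ y in 𝓝 p, ∀ᶠ x in 𝓝 p, gramKernel α x y = ω x * conj (ω y) * gramKernel β x y)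
    (u v : E) :
    fubiniStudy (α p) (fderiv ℂ α p u) (fderiv ℂ α p v) =
      fubiniStudy (β p) (fderiv ℂ β p u) (fderiv ℂ β p v) := by
  have hdω := differentiableAt_of_gramKernel_eq hα hβ hω₀ hβ₀ hω.self_of_nhds
  have hfd : ∀ u, fderiv ℂ (fun x => ω x • β x) p u =
      ω p • fderiv ℂ β p u + fderiv ℂ ω p u • β p := fun u => by
    rw [fderiv_fun_smul hdω hβ, add_apply, smul_apply, ContinuousLinearMap.smulRight_apply]
  rw [fubiniStudy_fderiv_eq_of_gramKernel_eq (β := fun x => ω x • β x) hα (hdω.smul hβ) ?_ u v,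
    hfd, hfd, fubiniStudy_smul hβ₀ hω₀]
  filter_upwards [hω] with y hy
  filter_upwards [hy] with x hx
  rw [hx, gramKernel, gramKernel, dualInner_smul_left, dualInner_smul_right]
  ring

theorem fubiniStudy_fderiv_eq_of_isRescaling (hX : IsOpen X) (hα : DifferentiableOn ℂ α X)
    (hβ : DifferentiableOn ℂ β X) (hp : p ∈ X) (hα₀ : α p ≠ 0)
    (h : IsRescaling (gramKernel fun x : X => α x) (gramKernel fun x : X => β x)) (u v : E) :
    fubiniStudy (α p) (fderiv ℂ α p u) (fderiv ℂ α p v) =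
      fubiniStudy (β p) (fderiv ℂ β p u) (fderiv ℂ β p v) := by
  obtain ⟨ω, hω⟩ := h
  have hωext : ∀ x : X, Function.extend Subtype.val ω 0 x = ω x :=
    Subtype.val_injective.extend_apply ω 0
  have hpp := dualInner_self_ne_zero hα₀
  change gramKernel (fun x : X => α x) ⟨p, hp⟩ ⟨p, hp⟩ ≠ 0 at hpp
  rw [hω] at hpp
  refine fubiniStudy_fderiv_eq_of_gramKernel_eq_mul (ω := Function.extend Subtype.val ω 0)
    (hα.differentiableAt (hX.mem_nhds hp)) (hβ.differentiableAt (hX.mem_nhds hp)) ?_ ?_ ?_ u v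
  · rw [hωext ⟨p, hp⟩]
    exact left_ne_zero_of_mul (left_ne_zero_of_mul hpp)
  · intro h₀
    exact right_ne_zero_of_mul hpp (by simp [gramKernel, h₀, dualInner_eq_apply])
  · filter_upwards [hX.mem_nhds hp] with y hy
    filter_upwards [hX.mem_nhds hp] with x hx
    rw [hωext ⟨x, hx⟩, hωext ⟨y, hy⟩]
    exact hω ⟨x, hx⟩ ⟨y, hy⟩

end RescalingInvariance

section Overlap

variable {F₁ F₂ : Type*} [NormedAddCommGroup F₁] [InnerProductSpace ℂ F₁] [CompleteSpace F₁]
  [NormedAddCommGroup F₂] [InnerProductSpace ℂ F₂] [CompleteSpace F₂]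

/-- The cosine `|⟨l, m⟩| / (‖l‖ ‖m‖)` of the angle between the complex lines spanned by `l` and
`m`, of which both `δ₁` and `δ₂` are strictly decreasing functions. -/
noncomputable def overlap (l m : StrongDual ℂ F₁) : ℝ :=
  ‖dualInner l m‖ / (‖l‖ * ‖m‖)

theorem overlap_nonneg (l m : StrongDual ℂ F₁) : 0 ≤ overlap l m := by
  unfold overlap
  positivity

theorem overlap_le_one (l m : StrongDual ℂ F₁) : overlap l m ≤ 1 :=
  div_le_one_of_le₀ (norm_dualInner_le l m) (by positivity)

theorem overlap_sq (l m : StrongDual ℂ F₁) :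
    overlap l m ^ 2 = ‖dualInner l m‖ ^ 2 / (‖l‖ ^ 2 * ‖m‖ ^ 2) := by
  rw [overlap, div_pow, mul_pow]

theorem delta₁_eq_iff_overlap_eq {l m : StrongDual ℂ F₁} {l' m' : StrongDual ℂ F₂} :
    delta₁ l m = delta₁ l' m' ↔ overlap l m = overlap l' m' := by
  have h := pow_le_one₀ (n := 2) (overlap_nonneg l m) (overlap_le_one l m)
  have h' := pow_le_one₀ (n := 2) (overlap_nonneg l' m') (overlap_le_one l' m')
  rw [delta₁, delta₁, ← overlap_sq, ← overlap_sq, Real.sqrt_inj (by linarith) (by linarith),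
    sub_right_inj, pow_left_inj₀ (overlap_nonneg _ _) (overlap_nonneg _ _) two_ne_zero]

theorem delta₂_eq_iff_overlap_eq {l m : StrongDual ℂ F₁} {l' m' : StrongDual ℂ F₂} :
    delta₂ l m = delta₂ l' m' ↔ overlap l m = overlap l' m' := by
  have h := overlap_le_one l m
  have h' := overlap_le_one l' m'
  rw [overlap] at h h'
  rw [delta₂, delta₂, Real.sqrt_inj (by linarith) (by linarith), sub_right_inj,
    mul_right_inj' two_ne_zero, overlap, overlap]

variable {Y : Type*} {α : Y → StrongDual ℂ F₁} {β : Y → StrongDual ℂ F₂}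

theorem overlap_eq_of_isRescaling (hα : ∀ x, α x ≠ 0)
    (h : IsRescaling (gramKernel α) (gramKernel β)) (x y : Y) :
    overlap (α x) (α y) = overlap (β x) (β y) := by
  obtain ⟨ω, hω⟩ := h
  have hnorm : ∀ x, ‖α x‖ = ‖ω x‖ * ‖β x‖ := fun x => by
    have hxx := congrArg norm (hω x x)
    simp only [gramKernel, dualInner_self, norm_mul, norm_pow, Complex.norm_real, norm_norm,
      RCLike.norm_conj] at hxx
    rw [← pow_left_inj₀ (norm_nonneg _) (by positivity) two_ne_zero, hxx]
    ring
  have hω₀ : ∀ x, ‖ω x‖ ≠ 0 := fun x =>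
    left_ne_zero_of_mul ((hnorm x).symm.trans_ne (norm_ne_zero_iff.mpr (hα x)))
  have hxy : ‖dualInner (α x) (α y)‖ = ‖ω x‖ * ‖ω y‖ * ‖dualInner (β x) (β y)‖ := by
    simpa only [gramKernel, norm_mul, RCLike.norm_conj] using congrArg norm (hω x y)
  rw [overlap, overlap, hxy, hnorm, hnorm, mul_mul_mul_comm,
    mul_div_mul_left _ _ (mul_ne_zero (hω₀ x) (hω₀ y))]

theorem rescalingDefect_self_eq_zero_of_overlap_eq {p x : Y} (hαx : α x ≠ 0) (hαp : α p ≠ 0)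
    (hβx : β x ≠ 0) (hβp : β p ≠ 0) (h : overlap (α x) (α p) = overlap (β x) (β p)) :
    rescalingDefect (gramKernel α) (gramKernel β) p x x = 0 := by
  rw [← norm_ne_zero_iff] at hαx hαp hβx hβp
  rw [overlap, overlap, div_eq_div_iff (mul_ne_zero hαx hαp) (mul_ne_zero hβx hβp)] at h
  have hsq : ((‖dualInner (α x) (α p)‖ : ℂ) * (‖β x‖ * ‖β p‖)) ^ 2 =
      (‖dualInner (β x) (β p)‖ * (‖α x‖ * ‖α p‖)) ^ 2 := by
    exact_mod_cast congrArg (fun r : ℝ => r ^ (2 : ℕ)) h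
  simp only [rescalingDefect, gramKernel, dualInner_mul_dualInner_swap, dualInner_self]
  linear_combination -hsq

end Overlap

section Equivalence

theorem tfae_isRescaling_gramKernel {F₁ F₂ E : Type*} [NormedAddCommGroup F₁]
    [InnerProductSpace ℂ F₁] [CompleteSpace F₁] [NormedAddCommGroup F₂] [InnerProductSpace ℂ F₂]
    [CompleteSpace F₂] [NormedAddCommGroup E] [NormedSpace ℂ E] {X : Set E}
    {α : E → StrongDual ℂ F₁} {β : E → StrongDual ℂ F₂} (hX : IsOpen X) (hXc : IsConnected X)
    (hα : DifferentiableOn ℂ α X) (hβ : DifferentiableOn ℂ β X) (hα₀ : ∀ x ∈ X, α x ≠ 0)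
    (hβ₀ : ∀ x ∈ X, β x ≠ 0) :
    List.TFAE [
      IsRescaling (gramKernel fun x : X => α x) (gramKernel fun x : X => β x),
      ∀ (x : X) (u v : E), fubiniStudy (α x) (fderiv ℂ α x u) (fderiv ℂ α x v) =
        fubiniStudy (β x) (fderiv ℂ β x u) (fderiv ℂ β x v),
      ∀ x y : X, overlap (α x) (α y) = overlap (β x) (β y)] := by
  obtain ⟨p, hp⟩ := hXc.nonempty
  have hrescaling := isRescaling_gramKernel_of_eventually_rescalingDefect_eq_zero hX
    hXc.isPreconnected hα hβ hα₀ hβ₀ hp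
  tfae_have 1 → 2 := fun h x =>
    fubiniStudy_fderiv_eq_of_isRescaling hX hα hβ x.2 (hα₀ x x.2) h
  tfae_have 1 → 3 := overlap_eq_of_isRescaling fun x => hα₀ x x.2
  tfae_have 2 → 1 := fun h => hrescaling <|
    eventually_rescalingDefect_eq_zero_of_fubiniStudy_eq hX hα hβ hp (hα₀ p hp) (hβ₀ p hp)
      fun x hx u => h ⟨x, hx⟩ u u
  tfae_have 3 → 1 := fun h => hrescaling <| by
    filter_upwards [hX.mem_nhds hp] with x hx
    exact rescalingDefect_self_eq_zero_of_overlap_eq (hα₀ x hx) (hα₀ p hp) (hβ₀ x hx) (hβ₀ p hp)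
      (h ⟨x, hx⟩ ⟨p, hp⟩)
  tfae_finish

end Equivalence

section Pullback

variable {n : ℕ} {X : Set (EuclideanSpace ℂ (Fin n))} {K L : X → X → ℂ}
  [Fact (opKernel K).PosSemidef] [Fact (opKernel L).PosSemidef]

theorem fubiniStudyPullback_eq_iff (hK : IsPosSemidefKernel K) (hL : IsPosSemidefKernel L) :
    fubiniStudyPullback K hK = fubiniStudyPullback L hL ↔ ∀ x u v,
      fubiniStudy (evalMap (RKHS.OfKernel (opKernel K)) x)
          (derivEval (RKHS.OfKernel (opKernel K)) x u)
          (derivEval (RKHS.OfKernel (opKernel K)) x v) =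
        fubiniStudy (evalMap (RKHS.OfKernel (opKernel L)) x)
          (derivEval (RKHS.OfKernel (opKernel L)) x u)
          (derivEval (RKHS.OfKernel (opKernel L)) x v) := by
  simp only [funext_iff, fubiniStudyPullback]

theorem delta₁Pullback_eq_iff (hK : IsPosSemidefKernel K) (hL : IsPosSemidefKernel L) :
    delta₁Pullback K hK = delta₁Pullback L hL ↔ ∀ x y,
      overlap (evalMap (RKHS.OfKernel (opKernel K)) x) (evalMap (RKHS.OfKernel (opKernel K)) y) =
        overlap (evalMap (RKHS.OfKernel (opKernel L)) x)
          (evalMap (RKHS.OfKernel (opKernel L)) y) := by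
  simp only [funext_iff, delta₁Pullback, delta₁_eq_iff_overlap_eq]

theorem delta₂Pullback_eq_iff (hK : IsPosSemidefKernel K) (hL : IsPosSemidefKernel L) :
    delta₂Pullback K hK = delta₂Pullback L hL ↔ ∀ x y,
      overlap (evalMap (RKHS.OfKernel (opKernel K)) x) (evalMap (RKHS.OfKernel (opKernel K)) y) =
        overlap (evalMap (RKHS.OfKernel (opKernel L)) x)
          (evalMap (RKHS.OfKernel (opKernel L)) y) := by
  simp only [funext_iff, delta₂Pullback, delta₂_eq_iff_overlap_eq]

end Pullback

end KernelMetric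

open KernelMetric

theorem mainTheorem4 (n : ℕ) (X : Set (EuclideanSpace ℂ (Fin n)))
    (hXopen : IsOpen X) (hXconn : IsConnected X)
    (K L : X → X → ℂ)
    (hKhol : KernelMetric.IsSesquiHolomorphic K) (hLhol : KernelMetric.IsSesquiHolomorphic L)
    (hKnd : KernelMetric.IsNondegenerate K) (hLnd : KernelMetric.IsNondegenerate L)
    (hKpsd : KernelMetric.IsPosSemidefKernel K) (hLpsd : KernelMetric.IsPosSemidefKernel L) :
    List.TFAE [
      KernelMetric.AreRescalings K L,
      KernelMetric.fubiniStudyPullback K hKpsd = KernelMetric.fubiniStudyPullback L hLpsd,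
      KernelMetric.delta₁Pullback K hKpsd = KernelMetric.delta₁Pullback L hLpsd,
      KernelMetric.delta₂Pullback K hKpsd = KernelMetric.delta₂Pullback L hLpsd] := by
  have : Fact (opKernel K).PosSemidef := ⟨hKpsd.opKernel_posSemidef⟩
  have : Fact (opKernel L).PosSemidef := ⟨hLpsd.opKernel_posSemidef⟩
  have htfae := tfae_isRescaling_gramKernel hXopen hXconn
    (hKhol.differentiableOn_evalMap hXopen) (hLhol.differentiableOn_evalMap hXopen)
    (fun _ => hKnd.extendZero_evalMap_ne_zero) (fun _ => hLnd.extendZero_evalMap_ne_zero)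
  simp only [extendZero_coe, gramKernel_evalMap] at htfae
  rw [areRescalings_iff_isRescaling fun x => (hLnd x).ne', fubiniStudyPullback_eq_iff,
    delta₁Pullback_eq_iff, delta₂Pullback_eq_iff]
  tfae_have 1 ↔ 2 := htfae.out 0 1
  tfae_have 1 ↔ 3 := htfae.out 0 2
  tfae_have 3 ↔ 4 := Iff.rfl
  tfae_finish
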